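/- Let $n\ge 1$ be an integer, let $m>0$ be such that $\mu:=\sqrt{n^2-4m^2}\in(0,n)$ (that is, $0<m<n/2$), and let $\gamma\ge 1$. For $s\in\mathbb{R}$ let $H^s(\mathbb{R}^n)$ be the Sobolev space of tempered distributions $u$ with $\|u\|_{H^s}:=\|\langle D\rangle^s u\|_{L^2}<\infty$, where $\langle D\rangle^s$ is the Fourier multiplier with symbol $(1+|\xi|^2)^{s/2}$. For $f\in H^\gamma(\mathbb{R}^n)$ and $g\in H^{\gamma-1}(\mathbb{R}^n)$ consider the homogeneous linear Cauchy problem $$\phi_{tt}-e^{-2t}\Delta\phi+n\,\phi_t+m^2\phi=0\quad\text{in }(0,\infty)\times\mathbb{R}^n,\qquad \phi(0,\cdot)=f,\quad \phi_t(0,\cdot)=g,$$ where the equation is understood in the sense of distributions. It has a unique solution $\phi\in C([0,\infty),H^\gamma(\mathbb{R}^n))\cap C^1([0,\infty),H^{\gamma-1}(\mathbb{R}^n))$. Moreover, there is a constant $C>0$, depending only on $n$, $m$ and $\gamma$, such that for all such $f,g$ and all $t\ge 0$ the solution satisfies the following estimates. (i) If $\mu\in(0,1)$, then $$\|\phi(t,\cdot)\|_{H^\gamma}\le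 C\,e^{-\frac{(n-1)t}{2}}\big(\|f\|_{H^\gamma}+\|g\|_{H^{\gamma-1}}\big),\qquad \|\phi_t(t,\cdot)\|_{H^{\gamma-1}}\le C\,e^{-\frac{(n-1)t}{2}}\big(\|f\|_{H^\gamma}+\|g\|_{H^{\gamma-1}}\big).$$ (ii) If $\mu\in[1,n)$, then $$\|\phi(t,\cdot)\|_{H^\gamma}\le C\,e^{\frac{(-n+\mu)t}{2}}\big(\|f\|_{H^\gamma}+\|g\|_{H^{\gamma-1}}\big),\qquad \|\phi_t(t,\cdot)\|_{H^{\gamma-1}}\le C\,e^{\frac{(-n+\mu)t}{2}}\big(\|f\|_{H^\gamma}+\|g\|_{H^{\gamma-1}}\big).$$ (iii) If $\mu\in(0,1)$ and in addition $g\in H^\gamma(\mathbb{R}^n)$, then $$\|\phi(t,\cdot)\|_{H^\gamma}\le C\,e^{-\frac{(n-1)t}{2}}\big(\|f\|_{H^\gamma}+e^{-\frac{(1-\mu)t}{2}}\|g\|_{H^\gamma}\big).$$ -/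

import Mathlib

noncomputable section

open MeasureTheory TemperedDistribution
open scoped SchwartzMap Laplacian

/-- `ℝⁿ` with the Euclidean norm. -/
abbrev Rn (n : ℕ) : Type := EuclideanSpace ℝ (Fin n)

/-- The (inhomogeneous, `L²`-based) Sobolev space `H^s(ℝⁿ)` of complex-valued tempered
distributions, as a vector space: those `u` for which `⟨D⟩^s u = 𝓕⁻¹((1 + |ξ|²)^{s/2} 𝓕 u)`
is in `L²(ℝⁿ)`. (Mathlib's Fourier transform is `∫ e^{-2πi x·ξ} u(x) dx`; with the convention
`∫ e^{-i x·ξ} u(x) dx` one gets the same space with an equivalent norm.) -/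
def sobolevSubmodule (n : ℕ) (s : ℝ) : Submodule ℂ 𝓢'(Rn n, ℂ) where
  carrier := {u | MemSobolev s 2 u}
  add_mem' hu hv := hu.add hv
  zero_mem' := memSobolev_fun_zero (Rn n) ℂ s 2
  smul_mem' c _ hu := hu.smul c

/-- The Sobolev space `H^s(ℝⁿ)`. It is a type synonym, because it carries the topology of its
norm `‖u‖_{H^s} = ‖⟨D⟩^s u‖_{L²}` (below), not the one induced from `𝓢'(ℝⁿ)`. -/
def SobolevSpace (n : ℕ) (s : ℝ) : Type := sobolevSubmodule n s

namespace SobolevSpace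

variable {n : ℕ} {s : ℝ}

instance : AddCommGroup (SobolevSpace n s) := inferInstanceAs (AddCommGroup (sobolevSubmodule n s))

instance : Module ℂ (SobolevSpace n s) := inferInstanceAs (Module ℂ (sobolevSubmodule n s))

/-- The tempered distribution underlying an element of `H^s(ℝⁿ)`. -/
def toDistr : SobolevSpace n s →ₗ[ℂ] 𝓢'(Rn n, ℂ) := (sobolevSubmodule n s).subtype

theorem toDistr_injective : Function.Injective (toDistr (n := n) (s := s)) :=
  Subtype.val_injective

theorem memSobolev (u : SobolevSpace n s) : MemSobolev s 2 (toDistr u) := u.2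

theorem lp_toDistr_injective :
    Function.Injective (Lp.toTemperedDistributionCLM ℂ (volume : Measure (Rn n)) 2) :=
  LinearMap.ker_eq_bot.mp Lp.ker_toTemperedDistributionCLM_eq_bot

/-- The `L²` function representing `⟨D⟩^s u`. -/
def besselRep (u : SobolevSpace n s) : Lp ℂ 2 (volume : Measure (Rn n)) :=
  Classical.choose u.memSobolev

theorem toDistr_besselRep (u : SobolevSpace n s) :
    Lp.toTemperedDistributionCLM ℂ (volume : Measure (Rn n)) 2 (besselRep u)
      = besselPotential (Rn n) ℂ s (toDistr u) :=
  (Classical.choose_spec u.memSobolev).symm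

/-- The map `u ↦ ⟨D⟩^s u` from `H^s(ℝⁿ)` to `L²(ℝⁿ)`. -/
def bessel : SobolevSpace n s →ₗ[ℂ] Lp ℂ 2 (volume : Measure (Rn n)) where
  toFun := besselRep
  map_add' u v := lp_toDistr_injective <| by
    rw [map_add, toDistr_besselRep, toDistr_besselRep, toDistr_besselRep, map_add, map_add]
  map_smul' c u := lp_toDistr_injective <| by
    rw [RingHom.id_apply, map_smul, toDistr_besselRep, toDistr_besselRep, map_smul, map_smul]

/-- The defining property of `bessel`, as an identity of tempered distributions. -/
theorem bessel_spec (u : SobolevSpace n s) :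
    ((bessel u : Lp ℂ 2 (volume : Measure (Rn n))) : 𝓢'(Rn n, ℂ))
      = besselPotential (Rn n) ℂ s (toDistr u) :=
  toDistr_besselRep u

theorem bessel_injective : Function.Injective (bessel (n := n) (s := s)) := by
  intro u v h
  apply toDistr_injective
  have h' := congrArg (Lp.toTemperedDistributionCLM ℂ (volume : Measure (Rn n)) 2) h
  have h'' : besselPotential (Rn n) ℂ s (toDistr u) = besselPotential (Rn n) ℂ s (toDistr v) := by
    rw [← toDistr_besselRep, ← toDistr_besselRep]
    exact h'
  simpa using congrArg (besselPotential (Rn n) ℂ (-s)) h''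

/-- The norm `‖u‖_{H^s} = ‖⟨D⟩^s u‖_{L²}`. -/
instance : NormedAddCommGroup (SobolevSpace n s) :=
  NormedAddCommGroup.induced _ _ bessel bessel_injective

instance : NormedSpace ℂ (SobolevSpace n s) :=
  NormedSpace.induced ℂ (SobolevSpace n s) (Lp ℂ 2 (volume : Measure (Rn n))) bessel

theorem norm_def (u : SobolevSpace n s) : ‖u‖ = ‖bessel u‖ := rfl

/-- The inclusion `H^s(ℝⁿ) ⊆ H^{s'}(ℝⁿ)` for `s' ≤ s`. -/
def incl {s s' : ℝ} (h : s' ≤ s) : SobolevSpace n s →ₗ[ℂ] SobolevSpace n s' where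
  toFun u := ⟨toDistr u, MemSobolev.mono h u.memSobolev⟩
  map_add' u v := toDistr_injective (map_add toDistr u v)
  map_smul' c u := toDistr_injective (map_smul toDistr c u)

theorem toDistr_incl {s s' : ℝ} (h : s' ≤ s) (u : SobolevSpace n s) :
    toDistr (incl h u) = toDistr u := by
  rw [incl]
  rfl

end SobolevSpace

open SobolevSpace

/-- `φ` solves the homogeneous linear de Sitter equation on `[0, ∞) × ℝⁿ`,
`φ_tt - e^{-2t} Δφ + n φ_t + m² φ = 0`, `φ(0) = f`, `φ_t(0) = g`,
in the energy class of order `γ`, that is, `φ ∈ C([0,∞), H^γ) ∩ C¹([0,∞), H^{γ-1})`,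
with time derivative `φt`. Only the values at times `t ≥ 0` matter. The equation holds in the
sense of (tempered) distributions: `φ_tt` is the time derivative of `φ_t` when tested with
Schwartz functions, and `Δ` is the distributional Laplacian. -/
structure IsDeSitterSolution (n : ℕ) (m γ : ℝ) (f : SobolevSpace n γ)
    (g : SobolevSpace n (γ - 1)) (φ : ℝ → SobolevSpace n γ)
    (φt : ℝ → SobolevSpace n (γ - 1)) : Prop where
  continuousOn : ContinuousOn φ (Set.Ici 0)
  continuousOn_deriv : ContinuousOn φt (Set.Ici 0)
  hasDeriv : ∀ t : ℝ, 0 ≤ t →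
    HasDerivWithinAt (fun τ => incl (sub_le_self γ zero_le_one) (φ τ)) (φt t) (Set.Ici 0) t
  init : φ 0 = f
  init_deriv : φt 0 = g
  equation : ∀ t : ℝ, 0 < t → ∀ ψ : 𝓢(Rn n, ℂ),
    HasDerivAt (fun τ : ℝ => toDistr (φt τ) ψ)
      ((Real.exp (-2 * t) : ℂ) * (Δ (toDistr (φ t))) ψ
        - (n : ℂ) * toDistr (φt t) ψ - (m : ℂ) ^ 2 * toDistr (φ t) ψ) t

end

/-! After a Fourier transform in x, the mode of frequency l = |2πξ| satisfies y'' + n y' + (l²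
e^{-2t} + m²) y = 0. Writing y = e^{-nt/2} v removes the damping: v'' = (μ²/4 - z²) v with z = l
e^{-t}. While z ≥ 1 the mode oscillates with slowly varying frequency, and WKB predicts an amplitude
z^{-1/2}, that is, growth e^{t/2}; `oscillatory_bound` proves this with an adapted energy. From T =
log l on (T = 0 if l ≤ 1), z² ≤ e^{-2(t-T)} is an integrable perturbation, and v grows at most like
e^{μ(t-T)/2} (`exists_growth_bound`). Chaining the two phases (`exists_mode_bound`) gives e^{T/2 +
μ(t-T)/2} ≤ e^{max(1,μ)t/2}, uniformly in l; multiplied by e^{-nt/2}, this is the rate in (i) and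
(ii). If v(0) = 0, the oscillatory phase starts from size |w(0)|/l = e^{-T}|w(0)|. Spending the
extra derivative of g, instead of keeping the weight 1/l for the norm, leaves the exponent μ(t-T)/2
- T/2 ≤ μt/2, which is (iii).

The isometry u ↦ ⟨ξ⟩^s û from H^s to L² turns the Cauchy problem into one on L² from which γ has
disappeared (`isDeSitterSolution_iff`). Modes that are jointly continuous in (t, ξ) act there as
bounded multipliers: their sup norms are the estimates, and dominated convergence gives regularity
in time (`isFourierSolution_of_symbols`). Uniqueness comes from an energy that cannot increase,
since both the damping and the decreasing factor e^{-2t} lower it (`IsFourierSolution.eq_zero`). -/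

noncomputable section

open MeasureTheory TemperedDistribution
open scoped SchwartzMap Laplacian
open SobolevSpace

/-! ### Linear ODEs depending continuously on a parameter -/

section LinearODE

open Set Filter BoundedContinuousFunction
open scoped Topology NNReal

variable {E : Type*} [NormedAddCommGroup E] [NormedSpace ℝ E]

/-- Integrating the weight `exp (2K|s|)` gains 1/(2K), so a Lipschitz constant K leaves the factor
1/2: this is the contraction constant of the weighted Picard map. -/
theorem norm_integral_le_of_norm_le_exp {h : ℝ → E} {K M : ℝ} (hK : 0 < K)
    (hh : ∀ s, ‖h s‖ ≤ K * M * Real.exp (2 * K * |s|)) (t : ℝ) :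
    ‖∫ s in (0 : ℝ)..t, h s‖ ≤ M / 2 * Real.exp (2 * K * |t|) := by
  have key : ∀ {g : ℝ → E}, (∀ s, ‖g s‖ ≤ K * M * Real.exp (2 * K * |s|)) → ∀ t, 0 ≤ t →
      ‖∫ s in (0 : ℝ)..t, g s‖ ≤ M / 2 * Real.exp (2 * K * t) := by
    intro g hg t ht
    have hM : 0 ≤ M := by
      have h1 := (norm_nonneg _).trans (hg 0)
      simp only [abs_zero, mul_zero, Real.exp_zero, mul_one] at h1
      exact nonneg_of_mul_nonneg_right h1 hK
    have hint : ∫ s in (0 : ℝ)..t, K * M * Real.exp (2 * K * s)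
        = M / 2 * Real.exp (2 * K * t) - M / 2 * Real.exp (2 * K * 0) := by
      apply intervalIntegral.integral_eq_sub_of_hasDerivAt
      · intro x _
        have h1 : HasDerivAt (fun y : ℝ => 2 * K * y) (2 * K) x := by
          simpa using (hasDerivAt_id x).const_mul (2 * K)
        exact (h1.exp.const_mul (M / 2)).congr_deriv (by ring)
      · exact (by fun_prop : Continuous fun s : ℝ => K * M * Real.exp (2 * K * s)).intervalIntegrable _ _
    calc ‖∫ s in (0 : ℝ)..t, g s‖ ≤ ∫ s in (0 : ℝ)..t, K * M * Real.exp (2 * K * s) := by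
          apply intervalIntegral.norm_integral_le_of_norm_le ht
          · filter_upwards with s hs
            simpa [abs_of_pos hs.1] using hg s
          · exact (by fun_prop :
              Continuous fun s : ℝ => K * M * Real.exp (2 * K * s)).intervalIntegrable _ _
      _ ≤ _ := by
          rw [hint]
          simp only [mul_zero, Real.exp_zero, mul_one]
          linarith
  rcases le_total 0 t with ht | ht
  · rw [abs_of_nonneg ht]
    exact key hh t ht
  · rw [abs_of_nonpos ht]
    have h2 := key (g := fun s => h (-s)) (fun s => by simpa using hh (-s)) (-t) (by linarith)
    rw [intervalIntegral.integral_comp_neg, neg_neg, neg_zero, intervalIntegral.integral_symm,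
      norm_neg] at h2
    exact h2

variable {P : Type*} [TopologicalSpace P]

/-- Global existence, with continuous dependence on a parameter, for a linearly bounded Lipschitz
ODE. The Picard map contracts in the norm with weight `exp (-2 K(p) |t|)`. -/
theorem exists_continuous_solution [CompleteSpace E] {F : ℝ → P → E → E} {K : P → ℝ}
    (hF : Continuous fun q : ℝ × P × E => F q.1 q.2.1 q.2.2)
    (hK : Continuous K) (hK0 : ∀ p, 0 < K p) (hF0 : ∀ t p, F t p 0 = 0)
    (hLip : ∀ t p x y, ‖F t p x - F t p y‖ ≤ K p * ‖x - y‖) (x₀ : E) :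
    ∃ X : ℝ → P → E, Continuous (Function.uncurry X) ∧ (∀ p, X 0 p = x₀) ∧
      ∀ t p, HasDerivAt (fun τ => X τ p) (F t p (X t p)) t := by
  -- The unknown is Y = exp (-2K(p)|t|) X, which is bounded on ℝ × P even if K is unbounded. Working
  -- with bounded continuous functions of (t, p) yields joint continuity at once.
  set G : (ℝ × P →ᵇ E) → ℝ × P → ℝ → E := fun Y q s =>
    F s q.2 (Real.exp (2 * K q.2 * |s|) • Y (s, q.2)) with hG
  have hGc : ∀ Y, Continuous (Function.uncurry (G Y)) := by
    intro Y
    have h1 : Continuous fun r : (ℝ × P) × ℝ =>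
        (r.2, r.1.2, Real.exp (2 * K r.1.2 * |r.2|) • Y (r.2, r.1.2)) := by
      fun_prop
    exact hF.comp h1
  have hFn : ∀ t p x, ‖F t p x‖ ≤ K p * ‖x‖ := by
    intro t p x
    simpa [hF0] using hLip t p x 0
  have hIc : ∀ Y, Continuous fun q : ℝ × P => ∫ s in (0 : ℝ)..q.1, G Y q s := fun Y =>
    intervalIntegral.continuous_parametric_intervalIntegral_of_continuous (hGc Y) continuous_fst
  have hGsub : ∀ Y Z q s, ‖G Y q s - G Z q s‖ ≤
      K q.2 * dist Y Z * Real.exp (2 * K q.2 * |s|) := by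
    intro Y Z q s
    refine (hLip _ _ _ _).trans ?_
    rw [← smul_sub, norm_smul, Real.norm_eq_abs, abs_of_pos (Real.exp_pos _), ← dist_eq_norm,
      mul_assoc (K q.2), mul_comm (dist Y Z)]
    exact mul_le_mul_of_nonneg_left (mul_le_mul_of_nonneg_left (Y.dist_coe_le_dist _)
      (Real.exp_pos _).le) (hK0 _).le
  have hG0 : ∀ q s, G 0 q s = 0 := by
    intro q s
    simp [hG, hF0]
  have hw : ∀ q : ℝ × P, Real.exp (-(2 * K q.2 * |q.1|)) ≤ 1 := by
    intro q
    rw [Real.exp_le_one_iff]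
    have := mul_nonneg (mul_nonneg zero_le_two (hK0 q.2).le) (abs_nonneg q.1)
    linarith
  have hsub : ∀ Y Z (q : ℝ × P), ‖Real.exp (-(2 * K q.2 * |q.1|)) • ∫ s in (0 : ℝ)..q.1,
      (G Y q s - G Z q s)‖ ≤ dist Y Z / 2 := by
    intro Y Z q
    rw [norm_smul, Real.norm_eq_abs, abs_of_pos (Real.exp_pos _)]
    have h1 := norm_integral_le_of_norm_le_exp (hK0 q.2) (hGsub Y Z q) q.1
    calc _ ≤ Real.exp (-(2 * K q.2 * |q.1|)) * (dist Y Z / 2 * Real.exp (2 * K q.2 * |q.1|)) :=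
          mul_le_mul_of_nonneg_left h1 (Real.exp_pos _).le
      _ = dist Y Z / 2 * (Real.exp (-(2 * K q.2 * |q.1|)) * Real.exp (2 * K q.2 * |q.1|)) := by ring
      _ = dist Y Z / 2 := by rw [← Real.exp_add]; simp
  let T : (ℝ × P →ᵇ E) → (ℝ × P →ᵇ E) := fun Y =>
    BoundedContinuousFunction.ofNormedAddCommGroup
      (fun q => Real.exp (-(2 * K q.2 * |q.1|)) • (x₀ + ∫ s in (0 : ℝ)..q.1, G Y q s))
      ((by fun_prop : Continuous fun q : ℝ × P => Real.exp (-(2 * K q.2 * |q.1|))).smul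
        (continuous_const.add (hIc Y)))
      (‖x₀‖ + dist Y 0 / 2)
      (by
        intro q
        rw [smul_add]
        refine (norm_add_le _ _).trans (add_le_add ?_ ?_)
        · rw [norm_smul, Real.norm_eq_abs, abs_of_pos (Real.exp_pos _)]
          exact mul_le_of_le_one_left (norm_nonneg _) (hw q)
        · simpa [hG0] using hsub Y 0 q)
  have hGi : ∀ Y q a b, IntervalIntegrable (G Y q) volume a b := fun Y q a b =>
    ((hGc Y).comp (Continuous.prodMk_right q)).intervalIntegrable _ _
  have hT : ContractingWith (1 / 2 : ℝ≥0) T := by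
    refine ⟨by norm_num, LipschitzWith.of_dist_le_mul fun Y Z => ?_⟩
    have h2 : ((1 / 2 : ℝ≥0) : ℝ) * dist Y Z = dist Y Z / 2 := by
      push_cast
      ring
    rw [h2, BoundedContinuousFunction.dist_le (by positivity)]
    intro q
    have h1 := hsub Y Z q
    rw [intervalIntegral.integral_sub (hGi Y q _ _) (hGi Z q _ _)] at h1
    rw [dist_eq_norm]
    refine le_of_eq_of_le (congrArg norm ?_) h1
    change Real.exp (-(2 * K q.2 * |q.1|)) • (x₀ + ∫ s in (0 : ℝ)..q.1, G Y q s)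
      - Real.exp (-(2 * K q.2 * |q.1|)) • (x₀ + ∫ s in (0 : ℝ)..q.1, G Z q s) = _
    rw [← smul_sub, add_sub_add_left_eq_sub]
  have : Nonempty (ℝ × P →ᵇ E) := ⟨0⟩
  set Y := ContractingWith.fixedPoint T hT
  have hY : T Y = Y := hT.fixedPoint_isFixedPt
  have hYq : ∀ q : ℝ × P, Real.exp (2 * K q.2 * |q.1|) • Y q = x₀ + ∫ s in (0 : ℝ)..q.1, G Y q s := by
    intro q
    have h1 : Y q = Real.exp (-(2 * K q.2 * |q.1|)) • (x₀ + ∫ s in (0 : ℝ)..q.1, G Y q s) := by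
      conv_lhs => rw [← hY]
      rfl
    rw [h1, smul_smul, ← Real.exp_add]
    simp
  refine ⟨fun t p => Real.exp (2 * K p * |t|) • Y (t, p), ?_, ?_, ?_⟩
  · have : Continuous fun q : ℝ × P => Real.exp (2 * K q.2 * |q.1|) • Y q := by fun_prop
    exact this
  · intro p
    simpa using hYq (0, p)
  · intro t p
    have h1 : (fun τ => Real.exp (2 * K p * |τ|) • Y (τ, p))
        = fun τ => x₀ + ∫ s in (0 : ℝ)..τ, F s p (Real.exp (2 * K p * |s|) • Y (s, p)) :=
      funext fun τ => hYq (τ, p)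
    rw [h1]
    have hc : Continuous fun s : ℝ => F s p (Real.exp (2 * K p * |s|) • Y (s, p)) :=
      (hGc Y).comp (Continuous.prodMk_right ((0 : ℝ), p))
    exact (hc.integral_hasStrictDerivAt 0 t).hasDerivAt.const_add x₀

/-- Solutions of `v'' = (c - l(p)² e^{-2|t|}) v`, jointly continuous in `(t, p)`. -/
theorem exists_mode_solution {l : P → ℝ} (hl : Continuous l) (c a b : ℝ) :
    ∃ v w : ℝ → P → ℝ, Continuous (Function.uncurry v) ∧ Continuous (Function.uncurry w) ∧
      (∀ p, v 0 p = a) ∧ (∀ p, w 0 p = b) ∧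
      (∀ t p, HasDerivAt (fun τ => v τ p) (w t p) t) ∧
      ∀ t p, HasDerivAt (fun τ => w τ p) ((c - l p ^ 2 * Real.exp (-2 * |t|)) * v t p) t := by
  -- With |t| in the exponent the coefficient is bounded by |c| + l² for negative times too, so one
  -- Lipschitz constant serves all of ℝ.
  obtain ⟨X, hX, hX0, hXd⟩ := exists_continuous_solution (E := ℝ × ℝ) (P := P)
    (F := fun t p x => (x.2, (c - l p ^ 2 * Real.exp (-2 * |t|)) * x.1))
    (K := fun p => 1 + |c| + l p ^ 2) (by fun_prop) (by fun_prop)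
    (fun p => by positivity) (fun t p => by simp) (fun t p x y => by
      have hq : |c - l p ^ 2 * Real.exp (-2 * |t|)| ≤ |c| + l p ^ 2 := by
        refine (abs_sub _ _).trans (add_le_add le_rfl ?_)
        rw [abs_of_nonneg (by positivity)]
        refine mul_le_of_le_one_right (by positivity) ?_
        rw [Real.exp_le_one_iff]
        have := abs_nonneg t
        linarith
      have h1 : |(x - y).1| ≤ ‖x - y‖ := norm_fst_le (x - y)
      have h2 : |(x - y).2| ≤ ‖x - y‖ := norm_snd_le (x - y)
      have h3 : 0 ≤ |c| + l p ^ 2 := by positivity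
      have h4 : 0 ≤ ‖x - y‖ := norm_nonneg _
      refine max_le ?_ ?_
      · change |(x - y).2| ≤ _
        nlinarith
      · change |(c - l p ^ 2 * Real.exp (-2 * |t|)) * x.1
          - (c - l p ^ 2 * Real.exp (-2 * |t|)) * y.1| ≤ _
        rw [← mul_sub, abs_mul]
        calc _ ≤ (|c| + l p ^ 2) * ‖x - y‖ := mul_le_mul hq h1 (abs_nonneg _) h3
          _ ≤ _ := by nlinarith) (a, b)
  refine ⟨fun t p => (X t p).1, fun t p => (X t p).2, continuous_fst.comp hX,
    continuous_snd.comp hX, fun p => congrArg Prod.fst (hX0 p), fun p => congrArg Prod.snd (hX0 p), fun t p => ?_, fun t p => ?_⟩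
  · exact (hXd t p).fst
  · exact (hXd t p).snd

end LinearODE

/-! ### Energy estimates in the two regimes of a mode -/

section ModeEstimates

open Set

/-- Grönwall's inequality with a variable coefficient `k = K'`. -/
theorem le_exp_sub_mul_of_deriv_le {N N' K k : ℝ → ℝ} {a b : ℝ} (hab : a ≤ b)
    (hN : ∀ t ∈ Icc a b, HasDerivAt N (N' t) t) (hK : ∀ t ∈ Icc a b, HasDerivAt K (k t) t)
    (hle : ∀ t ∈ Icc a b, N' t ≤ k t * N t) :
    N b ≤ Real.exp (K b - K a) * N a := by
  have hG : ∀ t ∈ Icc a b, HasDerivAt (fun t => Real.exp (-K t) * N t)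
      (Real.exp (-K t) * (N' t - k t * N t)) t := fun t ht =>
    ((hK t ht).neg.exp.mul (hN t ht)).congr_deriv
      (by simp only [Pi.neg_apply]; ring)
  have hanti : AntitoneOn (fun t => Real.exp (-K t) * N t) (Icc a b) := by
    refine antitoneOn_of_deriv_nonpos (convex_Icc a b)
      (fun t ht => (hG t ht).continuousAt.continuousWithinAt)
      (fun t ht => (hG t (interior_subset ht)).differentiableAt.differentiableWithinAt) ?_
    intro t ht
    rw [(hG t (interior_subset ht)).deriv]
    exact mul_nonpos_of_nonneg_of_nonpos (Real.exp_pos _).le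
      (sub_nonpos.2 (hle t (interior_subset ht)))
  have h := hanti (left_mem_Icc.2 hab) (right_mem_Icc.2 hab) hab
  calc N b = Real.exp (K b) * (Real.exp (-K b) * N b) := by
        rw [← mul_assoc, ← Real.exp_add]
        simp
    _ ≤ Real.exp (K b) * (Real.exp (-K a) * N a) :=
        mul_le_mul_of_nonneg_left h (Real.exp_pos _).le
    _ = _ := by
        rw [← mul_assoc, ← Real.exp_add, sub_eq_add_neg]

/-- Solutions of `v'' = (μ²/4 - q) v` with `|q(t)| ≤ e^{-2(t-T)}` grow at most like
`e^{μ(t-T)/2}` on `[T, ∞)`. -/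
theorem exists_growth_bound {μ : ℝ} (hμ : 0 < μ) :
    ∃ C : ℝ, 0 < C ∧ ∀ (v w q : ℝ → ℝ) (T : ℝ),
      (∀ t, T ≤ t → HasDerivAt v (w t) t) →
      (∀ t, T ≤ t → HasDerivAt w ((μ ^ 2 / 4 - q t) * v t) t) →
      (∀ t, T ≤ t → |q t| ≤ Real.exp (-2 * (t - T))) →
      ∀ t, T ≤ t → |v t| ≤ C * Real.exp (μ * (t - T) / 2) * (|v T| + |w T|) ∧
        |w t| ≤ C * Real.exp (μ * (t - T) / 2) * (|v T| + |w T|) := by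
  -- e^{1/μ} is the total effect of the perturbation, as (2/μ) e^{-2s} has integral 1/μ over [0, ∞);
  -- the other factor bounds the energy at T by the data.
  set M : ℝ := Real.exp (1 / μ) * (2 + μ ^ 2 / 2) with hM
  have hM0 : 0 < M := by positivity
  refine ⟨Real.sqrt M * (1 + 2 / μ), by positivity, fun v w q T hv hw hq t ht => ?_⟩
  -- The weights are balanced so that 2μ|vw| is at most this energy: without q it then grows at rate
  -- exactly μ, and v and w at rate μ/2.
  have hN : ∀ s ∈ Icc T t, HasDerivAt (fun s => 2 * w s ^ 2 + μ ^ 2 / 2 * v s ^ 2)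
      (2 * μ ^ 2 * (v s * w s) - 4 * q s * (v s * w s)) s := fun s hs =>
    ((((hw s hs.1).pow 2).const_mul 2).add (((hv s hs.1).pow 2).const_mul (μ ^ 2 / 2))).congr_deriv
      (by norm_num; ring)
  have hK : ∀ s ∈ Icc T t, HasDerivAt (fun s => μ * (s - T) - 1 / μ * Real.exp (-2 * (s - T)))
      (μ + 2 / μ * Real.exp (-2 * (s - T))) s := fun s _ => by
    have h1 : HasDerivAt (fun s : ℝ => s - T) 1 s := (hasDerivAt_id s).sub_const T
    exact ((h1.const_mul μ).sub ((h1.const_mul (-2)).exp.const_mul (1 / μ))).congr_deriv (by ring)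
  have hmain := le_exp_sub_mul_of_deriv_le ht hN hK (fun s hs => by
    have h1 : 2 * (μ * |v s * w s|) ≤ 2 * w s ^ 2 + μ ^ 2 / 2 * v s ^ 2 := by
      rw [abs_mul]
      nlinarith [sq_nonneg (2 * |w s| - μ * |v s|), sq_abs (w s), sq_abs (v s)]
    have h2 : 2 * μ ^ 2 * (v s * w s) ≤ μ * (2 * w s ^ 2 + μ ^ 2 / 2 * v s ^ 2) := by
      nlinarith [le_abs_self (v s * w s), mul_le_mul_of_nonneg_left h1 hμ.le, sq_nonneg μ]
    have h3 : -(4 * q s * (v s * w s)) ≤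
        2 / μ * Real.exp (-2 * (s - T)) * (2 * w s ^ 2 + μ ^ 2 / 2 * v s ^ 2) := by
      calc -(4 * q s * (v s * w s)) ≤ |4 * q s * (v s * w s)| := neg_le_abs _
        _ = |q s| * (4 * |v s * w s|) := by
            rw [abs_mul, abs_mul]
            norm_num
            ring
        _ ≤ Real.exp (-2 * (s - T)) * (4 * |v s * w s|) :=
            mul_le_mul_of_nonneg_right (hq s hs.1) (by positivity)
        _ = 2 / μ * Real.exp (-2 * (s - T)) * (2 * (μ * |v s * w s|)) := by
            field_simp
            ring
        _ ≤ _ := mul_le_mul_of_nonneg_left h1 (by positivity)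
    linarith)
  set A := |v T| + |w T| with hA
  have hA0 : 0 ≤ A := by positivity
  set e := Real.exp (μ * (t - T) / 2) with he
  have hNt : 2 * w t ^ 2 + μ ^ 2 / 2 * v t ^ 2 ≤ M * (e * A) ^ 2 := by
    refine hmain.trans ?_
    have h1 : Real.exp (μ * (t - T) - 1 / μ * Real.exp (-2 * (t - T)) -
        (μ * (T - T) - 1 / μ * Real.exp (-2 * (T - T)))) ≤ e ^ 2 * Real.exp (1 / μ) := by
      rw [he, ← Real.exp_nat_mul, ← Real.exp_add]
      apply Real.exp_le_exp.2
      have : 0 ≤ 1 / μ * Real.exp (-2 * (t - T)) := by positivity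
      simp only [sub_self, mul_zero, Real.exp_zero, mul_one]
      push_cast
      linarith
    have h2 : 2 * w T ^ 2 + μ ^ 2 / 2 * v T ^ 2 ≤ (2 + μ ^ 2 / 2) * A ^ 2 := by
      have hv2 : v T ^ 2 ≤ A ^ 2 := by
        rw [← sq_abs]
        exact pow_le_pow_left₀ (abs_nonneg _) (by simp [hA]) 2
      have hw2 : w T ^ 2 ≤ A ^ 2 := by
        rw [← sq_abs]
        exact pow_le_pow_left₀ (abs_nonneg _) (by simp [hA]) 2
      nlinarith [sq_nonneg μ]
    calc _ ≤ (e ^ 2 * Real.exp (1 / μ)) * ((2 + μ ^ 2 / 2) * A ^ 2) :=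
          mul_le_mul h1 h2 (by positivity) (by positivity)
      _ = _ := by rw [hM]; ring
  have hsq : (Real.sqrt M * (e * A)) ^ 2 = M * (e * A) ^ 2 := by
    rw [mul_pow, Real.sq_sqrt hM0.le]
  have hB0 : 0 ≤ Real.sqrt M * (e * A) := by positivity
  have hwB : |w t| ≤ Real.sqrt M * (e * A) := by
    apply abs_le_of_sq_le_sq _ hB0
    rw [hsq]
    nlinarith [sq_nonneg (w t), sq_nonneg (μ * v t)]
  have hvB : μ / 2 * |v t| ≤ Real.sqrt M * (e * A) := by
    rw [← abs_of_pos (half_pos hμ), ← abs_mul]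
    apply abs_le_of_sq_le_sq _ hB0
    rw [hsq]
    nlinarith [sq_nonneg (w t), sq_nonneg (μ * v t)]
  constructor
  · have h1 : |v t| ≤ 2 / μ * (Real.sqrt M * (e * A)) := by
      calc |v t| = 2 / μ * (μ / 2 * |v t|) := by field_simp
        _ ≤ _ := mul_le_mul_of_nonneg_left hvB (by positivity)
    calc |v t| ≤ 2 / μ * (Real.sqrt M * (e * A)) := h1
      _ ≤ Real.sqrt M * (e * A) + 2 / μ * (Real.sqrt M * (e * A)) := by linarith
      _ = _ := by ring
  · have h2 : 0 ≤ 2 / μ * (Real.sqrt M * (e * A)) := by positivity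
    calc |w t| ≤ Real.sqrt M * (e * A) + 2 / μ * (Real.sqrt M * (e * A)) := by linarith
      _ = _ := by ring

/-- The oscillatory regime `1 ≤ z = l e^{-t}`: the energy `z v² + (w - v/2)² / z` of a solution of
`v' = w`, `w' = (μ²/4 - z²) v` stays bounded. -/
theorem oscillatory_bound (μ : ℝ) {l : ℝ} (hl : 1 ≤ l) {v w : ℝ → ℝ}
    (hv : ∀ t, 0 ≤ t → HasDerivAt v (w t) t)
    (hw : ∀ t, 0 ≤ t → HasDerivAt w ((μ ^ 2 / 4 - l ^ 2 * Real.exp (-2 * t)) * v t) t)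
    {t : ℝ} (ht : 0 ≤ t) (htl : Real.exp t ≤ l) :
    |v t| ≤ Real.sqrt (2 * Real.exp |(μ ^ 2 - 1) / 4|) * Real.exp (t / 2)
        * (|v 0| + |w 0| / l) ∧
      |w t| ≤ 2 * Real.sqrt (2 * Real.exp |(μ ^ 2 - 1) / 4|) * (l * Real.exp (-(t / 2)))
        * (|v 0| + |w 0| / l) := by
  have hl0 : 0 < l := by linarith
  set c := (μ ^ 2 - 1) / 4 with hc
  -- Since z' = -z, the derivative of √z v is √z (w - v/2). With this correction everything in the
  -- derivative of the energy cancels except the cross term 2c (w - v/2) v / z.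
  have hN : ∀ s ∈ Icc 0 t, HasDerivAt
      (fun s => l * Real.exp (-s) * v s ^ 2 + 1 / l * Real.exp s * (w s - v s / 2) ^ 2)
      (2 * c * (1 / l * Real.exp s) * ((w s - v s / 2) * v s)) s := fun s hs => by
    have e1 : HasDerivAt (fun s : ℝ => Real.exp (-s)) (-Real.exp (-s)) s :=
      (hasDerivAt_neg s).exp.congr_deriv (by ring)
    have e2 := Real.hasDerivAt_exp s
    have d := (hw s hs.1).sub ((hv s hs.1).div_const 2)
    refine (((e1.const_mul l).mul ((hv s hs.1).pow 2)).add
      ((e2.const_mul (1 / l)).mul (d.pow 2))).congr_deriv ?_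
    have hx : Real.exp (-2 * s) = Real.exp (-s) ^ 2 := by
      rw [← Real.exp_nat_mul]
      congr 1
      push_cast
      ring
    have hy : Real.exp s = (Real.exp (-s))⁻¹ := by rw [Real.exp_neg, inv_inv]
    rw [hx, hy, hc]
    have := (Real.exp_pos (-s)).ne'
    simp only [Nat.cast_ofNat, Pi.sub_apply, Pi.pow_apply]
    field_simp
    ring
  -- The rate |c|/z = |c| e^s / l is its own primitive and increases by at most |c| as long as e^t ≤
  -- l; hence the factor e^{|c|}.
  have hK : ∀ s ∈ Icc 0 t, HasDerivAt (fun s => |c| * (1 / l) * Real.exp s)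
      (|c| * (1 / l) * Real.exp s) s := fun s _ => (Real.hasDerivAt_exp s).const_mul _
  have hmain := le_exp_sub_mul_of_deriv_le ht hN hK (fun s _ => by
    set x := Real.exp s with hx
    have hx0 : 0 < x := Real.exp_pos s
    have hxi : Real.exp (-s) = x⁻¹ := Real.exp_neg s
    rw [hxi]
    set d := w s - v s / 2
    have h1 : 2 * |d * v s| ≤ l * x⁻¹ * v s ^ 2 + 1 / l * x * d ^ 2 := by
      have h2 : l * x⁻¹ * v s ^ 2 + 1 / l * x * d ^ 2 - 2 * |d * v s|
          = l * x⁻¹ * (|v s| - x / l * |d|) ^ 2 := by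
        rw [abs_mul, ← sq_abs (v s), ← sq_abs d]
        field_simp
        ring
      have h3 : 0 ≤ l * x⁻¹ * (|v s| - x / l * |d|) ^ 2 := by positivity
      linarith
    calc 2 * c * (1 / l * x) * (d * v s) ≤ |2 * c * (1 / l * x) * (d * v s)| := le_abs_self _
      _ = |c| * (1 / l) * x * (2 * |d * v s|) := by
          rw [abs_mul, abs_mul, abs_mul, abs_of_pos (by positivity : 0 < 1 / l * x)]
          norm_num
          ring
      _ ≤ _ := mul_le_mul_of_nonneg_left h1 (by positivity))
  set A := |v 0| + |w 0| / l with hA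
  have hA0 : 0 ≤ A := by positivity
  set S := Real.sqrt (2 * Real.exp |c|) with hS
  have hS2 : S ^ 2 = 2 * Real.exp |c| := Real.sq_sqrt (by positivity)
  have hS0 : 0 ≤ S := Real.sqrt_nonneg _
  set h := Real.exp (t / 2) with hh
  have hh0 : 0 < h := Real.exp_pos _
  have hht : Real.exp t = h ^ 2 := by
    rw [hh, ← Real.exp_nat_mul]
    congr 1
    push_cast
    ring
  have hhn : Real.exp (-t) = (h ^ 2)⁻¹ := by rw [Real.exp_neg, hht]
  have hhi : Real.exp (-(t / 2)) = h⁻¹ := Real.exp_neg _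
  have hE0 : l * Real.exp (-0) * v 0 ^ 2 + 1 / l * Real.exp 0 * (w 0 - v 0 / 2) ^ 2
      ≤ 2 * l * A ^ 2 := by
    simp only [neg_zero, Real.exp_zero, mul_one]
    have h1 : v 0 ^ 2 ≤ A ^ 2 := by
      rw [← sq_abs]
      exact pow_le_pow_left₀ (abs_nonneg _) (by rw [hA]; linarith [div_nonneg (abs_nonneg (w 0)) hl0.le]) 2
    have h2 : (w 0 - v 0 / 2) ^ 2 ≤ (l * A) ^ 2 := by
      rw [← sq_abs]
      refine pow_le_pow_left₀ (abs_nonneg _) ?_ 2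
      calc |w 0 - v 0 / 2| ≤ |w 0| + |v 0 / 2| := abs_sub _ _
        _ ≤ |w 0| + l * |v 0| := by
            rw [abs_div, abs_two]
            nlinarith [abs_nonneg (v 0)]
        _ = l * A := by rw [hA]; field_simp; ring
    have h3 : 1 / l * (w 0 - v 0 / 2) ^ 2 ≤ 1 / l * (l * A) ^ 2 :=
      mul_le_mul_of_nonneg_left h2 (by positivity)
    have h4 : 1 / l * (l * A) ^ 2 = l * A ^ 2 := by field_simp
    nlinarith
  have hEt : l * Real.exp (-t) * v t ^ 2 + 1 / l * Real.exp t * (w t - v t / 2) ^ 2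
      ≤ S ^ 2 * l * A ^ 2 := by
    refine hmain.trans ?_
    have h1 : Real.exp (|c| * (1 / l) * Real.exp t - |c| * (1 / l) * Real.exp 0) ≤
        Real.exp |c| := by
      apply Real.exp_le_exp.2
      have h2 : 1 / l * Real.exp t ≤ 1 := by
        rw [one_div, inv_mul_le_iff₀ hl0]
        linarith
      have h3 : 0 ≤ |c| * (1 / l) * Real.exp 0 := by positivity
      nlinarith [abs_nonneg c]
    calc _ ≤ Real.exp |c| * (2 * l * A ^ 2) :=
          mul_le_mul h1 hE0 (by positivity) (by positivity)
      _ = _ := by rw [hS2]; ring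
  rw [hhn, hht] at hEt
  have hvt : |v t| ≤ S * h * A := by
    apply abs_le_of_sq_le_sq _ (by positivity)
    have h1 : 0 ≤ 1 / l * h ^ 2 * (w t - v t / 2) ^ 2 := by positivity
    have h2 : l * (h ^ 2)⁻¹ * v t ^ 2 ≤ S ^ 2 * l * A ^ 2 := by linarith
    calc v t ^ 2 = h ^ 2 / l * (l * (h ^ 2)⁻¹ * v t ^ 2) := by field_simp
      _ ≤ h ^ 2 / l * (S ^ 2 * l * A ^ 2) := mul_le_mul_of_nonneg_left h2 (by positivity)
      _ = (S * h * A) ^ 2 := by field_simp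
  have hdt : |w t - v t / 2| ≤ S * (l * h⁻¹) * A := by
    apply abs_le_of_sq_le_sq _ (by positivity)
    have h1 : 0 ≤ l * (h ^ 2)⁻¹ * v t ^ 2 := by positivity
    have h2 : 1 / l * h ^ 2 * (w t - v t / 2) ^ 2 ≤ S ^ 2 * l * A ^ 2 := by linarith
    calc (w t - v t / 2) ^ 2 = l / h ^ 2 * (1 / l * h ^ 2 * (w t - v t / 2) ^ 2) := by field_simp
      _ ≤ l / h ^ 2 * (S ^ 2 * l * A ^ 2) := mul_le_mul_of_nonneg_left h2 (by positivity)
      _ = (S * (l * h⁻¹) * A) ^ 2 := by field_simp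
  refine ⟨hvt, ?_⟩
  rw [hhi]
  have hhl : h ≤ l * h⁻¹ := by
    rw [← div_eq_mul_inv, le_div_iff₀ hh0, ← pow_two, ← hht]
    exact htl
  have h1 : S * h * A ≤ S * (l * h⁻¹) * A :=
    mul_le_mul_of_nonneg_right (mul_le_mul_of_nonneg_left hhl hS0) hA0
  calc |w t| = |(w t - v t / 2) + v t / 2| := by ring_nf
    _ ≤ |w t - v t / 2| + |v t / 2| := abs_add_le _ _
    _ ≤ S * (l * h⁻¹) * A + S * (l * h⁻¹) * A := by
        rw [abs_div, abs_two]
        have := abs_nonneg (v t)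
        linarith
    _ = _ := by ring

end ModeEstimates

/-! ### Uniform bounds for Fourier modes -/

section Modes

/-- The growth of a single Fourier mode with frequency `l`, uniformly in `l ≥ 0`. -/
theorem exists_mode_bound {μ : ℝ} (hμ : 0 < μ) :
    ∃ C : ℝ, 0 < C ∧ ∀ (l : ℝ) (v w : ℝ → ℝ), 0 ≤ l →
      (∀ t, 0 ≤ t → HasDerivAt v (w t) t) →
      (∀ t, 0 ≤ t → HasDerivAt w ((μ ^ 2 / 4 - l ^ 2 * Real.exp (-2 * t)) * v t) t) →
      ∀ t, 0 ≤ t →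
        |v t| ≤ C * Real.exp (max 1 μ * t / 2) * (|v 0| + |w 0| / max 1 l) ∧
        |w t| ≤ C * Real.exp (max 1 μ * t / 2) * max 1 l * (|v 0| + |w 0| / max 1 l) ∧
        (μ ≤ 1 → v 0 = 0 → |v t| ≤ C * Real.exp (μ * t / 2) * |w 0|) := by
  obtain ⟨C₁, hC₁, hgrow⟩ := exists_growth_bound hμ
  set S := Real.sqrt (2 * Real.exp |(μ ^ 2 - 1) / 4|) with hS
  have hS0 : 0 < S := Real.sqrt_pos.2 (by positivity)
  -- C₁ serves low frequencies, 2S the oscillatory phase, and 3C₁S both phases in succession, where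
  -- 3 = 1 + 2 bounds |v| + |w| at the transition.
  refine ⟨C₁ + 2 * S + 3 * C₁ * S, by positivity, fun l v w hl hv hw t ht => ?_⟩
  set C := C₁ + 2 * S + 3 * C₁ * S with hC
  set κ := max 1 μ with hκ
  have hκ1 : 1 ≤ κ := le_max_left _ _
  have hκμ : μ ≤ κ := le_max_right _ _
  set L := max 1 l with hL
  have hL1 : 1 ≤ L := le_max_left _ _
  set A := |v 0| + |w 0| / L with hA
  have hA0 : 0 ≤ A := by positivity
  have hCC1 : C₁ ≤ C := by
    have : 0 < C₁ * S := by positivity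
    linarith
  have hCS : 2 * S ≤ C := by
    have : 0 < C₁ * S := by positivity
    linarith
  have hCCS : 3 * C₁ * S ≤ C := by linarith
  have fin : ∀ {x c e e' B : ℝ}, x ≤ c * Real.exp e * B → 0 ≤ c → c ≤ C → e ≤ e' → 0 ≤ B →
      x ≤ C * Real.exp e' * B := by
    intro x c e e' B hx hc0 hc he hB
    refine hx.trans ?_
    have := Real.exp_le_exp.2 he
    gcongr
  have le_mulL : ∀ {x B : ℝ}, 0 ≤ B → x ≤ C * Real.exp (κ * t / 2) * B →
      x ≤ C * Real.exp (κ * t / 2) * L * B := by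
    intro x B hB hx
    refine hx.trans (mul_le_mul_of_nonneg_right ?_ hB)
    exact le_mul_of_one_le_right (by positivity) hL1
  have hμκt : μ * t / 2 ≤ κ * t / 2 := by nlinarith
  rcases le_or_gt l 1 with hl1 | hl1
  -- Low frequencies have no oscillatory phase: the growth bound applies from T = 0.
  · have hLe : L = 1 := max_eq_left hl1
    have h := hgrow v w (fun t => l ^ 2 * Real.exp (-2 * t)) 0 hv hw (fun t _ => by
      rw [abs_of_nonneg (by positivity), sub_zero]
      exact mul_le_of_le_one_left (Real.exp_pos _).le (by nlinarith)) t ht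
    rw [sub_zero] at h
    have hAe : |v 0| + |w 0| = A := by rw [hA, hLe, div_one]
    rw [hAe] at h
    refine ⟨fin h.1 hC₁.le hCC1 hμκt hA0, le_mulL hA0 (fin h.2 hC₁.le hCC1 hμκt hA0),
      fun _ h0 => ?_⟩
    have hAw : A = |w 0| := by rw [hA, h0, hLe]; simp
    rw [← hAw]
    exact fin h.1 hC₁.le hCC1 le_rfl hA0
  · have hLe : L = l := max_eq_right hl1.le
    have hl0 : 0 < l := by linarith
    have hosc : ∀ s, 0 ≤ s → Real.exp s ≤ l → _ := fun s hs hsl =>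
      oscillatory_bound μ hl1.le hv hw hs hsl
    rw [← hLe] at hosc
    rcases le_or_gt (Real.exp t) l with htl | htl
    · have h := hosc t ht (hLe ▸ htl)
      refine ⟨fin h.1 hS0.le (by linarith) (by nlinarith) hA0, ?_, fun _ h0 => ?_⟩
      · have h2 : |w t| ≤ 2 * S * Real.exp (-(t / 2)) * (L * A) := by
          refine h.2.trans_eq ?_
          ring
        have h3 := fin (e' := κ * t / 2) h2 (by positivity) hCS (by nlinarith) (by positivity)
        exact h3.trans_eq (by ring)
      -- Before the transition e^t ≤ l, so the weight 1/l turns the growth e^{t/2} into decay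
      -- e^{-t/2}.
      · have h2 : |v t| ≤ S * Real.exp (-(t / 2)) * |w 0| := by
          refine h.1.trans ?_
          rw [h0, abs_zero, zero_add, mul_assoc, mul_assoc]
          refine mul_le_mul_of_nonneg_left ?_ hS0.le
          rw [← mul_div_assoc, mul_comm, mul_div_assoc, mul_comm]
          refine mul_le_mul_of_nonneg_right ?_ (abs_nonneg _)
          rw [div_le_iff₀ (by linarith), hLe]
          refine le_trans ?_ (mul_le_mul_of_nonneg_left htl (Real.exp_pos _).le)
          rw [← Real.exp_add]
          exact Real.exp_le_exp.2 (by linarith)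
        exact fin h2 hS0.le (by linarith) (by nlinarith) (abs_nonneg _)
    -- At the transition time z = l e^{-T} = 1 the oscillatory bounds for v and w both have size
    -- e^{T/2}, so they can serve as data for the second phase.
    · set T := Real.log l with hT
      have hTl : Real.exp T = l := Real.exp_log hl0
      have hT0 : 0 ≤ T := Real.log_nonneg hl1.le
      have hTt : T ≤ t := by
        rw [hT, Real.log_le_iff_le_exp hl0]
        exact htl.le
      have hoT := hosc T hT0 (by rw [hTl, hLe])
      have hsum : |v T| + |w T| ≤ 3 * S * (Real.exp (T / 2) * A) := by
        have h1 : L * Real.exp (-(T / 2)) = Real.exp (T / 2) := by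
          rw [hLe, ← hTl, ← Real.exp_add]
          congr 1
          ring
        rw [h1] at hoT
        linarith [hoT.1, hoT.2]
      have h := hgrow v w (fun t => l ^ 2 * Real.exp (-2 * t)) T (fun s hs => hv s (hT0.trans hs))
        (fun s hs => hw s (hT0.trans hs)) (fun s _ => by
          rw [abs_of_nonneg (by positivity)]
          apply le_of_eq
          rw [← hTl, ← Real.exp_nat_mul, ← Real.exp_add]
          congr 1
          push_cast
          ring) t hTt
      have key : ∀ {x : ℝ}, x ≤ C₁ * Real.exp (μ * (t - T) / 2) * (|v T| + |w T|) →
          x ≤ 3 * C₁ * S * Real.exp (μ * (t - T) / 2 + T / 2) * A := by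
        intro x hx
        refine hx.trans ((mul_le_mul_of_nonneg_left hsum (by positivity)).trans_eq ?_)
        rw [Real.exp_add]
        ring
      have hexp : μ * (t - T) / 2 + T / 2 ≤ κ * t / 2 := by nlinarith
      have hpos : 0 ≤ 3 * C₁ * S := by positivity
      refine ⟨fin (key h.1) hpos hCCS hexp hA0, le_mulL hA0 (fin (key h.2) hpos hCCS hexp hA0),
        fun _ h0 => ?_⟩
      -- The weight 1/l is e^{-T}, which outweighs the growth e^{T/2} of the oscillatory phase and
      -- leaves only the rate μ/2.
      have hAw : A = Real.exp (-T) * |w 0| := by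
        rw [hA, h0, hLe, ← hTl, Real.exp_neg, abs_zero]
        field_simp
        simp
      have h2 : |v t| ≤ 3 * C₁ * S * Real.exp (μ * (t - T) / 2 + T / 2 + -T) * |w 0| := by
        refine (key h.1).trans_eq ?_
        rw [hAw, Real.exp_add _ (-T)]
        ring
      exact fin h2 hpos hCCS (by nlinarith) (abs_nonneg _)

variable {n : ℕ}

/-- The Japanese bracket `⟨ξ⟩^s = (1 + |ξ|²)^{s/2}`. -/
def bracket (s : ℝ) (ξ : Rn n) : ℝ := (1 + ‖ξ‖ ^ 2) ^ (s / 2)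

theorem bracket_pos (s : ℝ) (ξ : Rn n) : 0 < bracket s ξ := by
  rw [bracket]
  positivity

theorem bracket_mul (s s' : ℝ) (ξ : Rn n) : bracket s ξ * bracket s' ξ = bracket (s + s') ξ := by
  rw [bracket, bracket, bracket, ← Real.rpow_add (by positivity), add_div]

theorem bracket_zero (ξ : Rn n) : bracket 0 ξ = 1 := by simp [bracket]

theorem bracket_two (ξ : Rn n) : bracket 2 ξ = 1 + ‖ξ‖ ^ 2 := by simp [bracket]

theorem bracket_neg_mul (s : ℝ) (ξ : Rn n) : bracket (-s) ξ * bracket s ξ = 1 := by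
  rw [bracket_mul, neg_add_cancel, bracket_zero]

theorem continuous_bracket (s : ℝ) : Continuous (bracket (n := n) s) := by
  unfold bracket
  refine Continuous.rpow_const (by fun_prop) fun ξ => Or.inl ?_
  positivity

theorem bracket_one_sq (ξ : Rn n) : bracket 1 ξ ^ 2 = 1 + ‖ξ‖ ^ 2 := by
  rw [sq, bracket_mul, one_add_one_eq_two, bracket_two]

theorem one_le_bracket_one (ξ : Rn n) : 1 ≤ bracket 1 ξ := by
  nlinarith [bracket_one_sq ξ, bracket_pos 1 ξ, sq_nonneg ‖ξ‖]

theorem norm_le_bracket_one (ξ : Rn n) : ‖ξ‖ ≤ bracket 1 ξ := by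
  nlinarith [bracket_one_sq ξ, bracket_pos 1 ξ, norm_nonneg ξ]

theorem bracket_neg_one_le_one (ξ : Rn n) : bracket (-1) ξ ≤ 1 := by
  have h := bracket_neg_mul 1 ξ
  nlinarith [bracket_pos (-1) ξ, one_le_bracket_one ξ]

theorem bracket_neg_one (ξ : Rn n) : bracket (-1) ξ = (bracket 1 ξ)⁻¹ :=
  eq_inv_of_mul_eq_one_left (bracket_neg_mul 1 ξ)

/-- The frequency `|2πξ|`, in the normalisation in which `Δ` has symbol `-|2πξ|²`. -/
def freq (ξ : Rn n) : ℝ := 2 * Real.pi * ‖ξ‖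

theorem freq_nonneg (ξ : Rn n) : 0 ≤ freq ξ := by
  rw [freq]
  positivity

theorem continuous_freq : Continuous (freq (n := n)) := by
  unfold freq
  fun_prop

theorem freq_le (ξ : Rn n) : freq ξ ≤ 7 * bracket 1 ξ := by
  rw [freq]
  nlinarith [norm_le_bracket_one ξ, norm_nonneg ξ, Real.pi_lt_d2, Real.pi_pos]

/-- Together with `bracket_one_le_max_freq`, this exchanges the natural weight of the modes for that
of the Sobolev norms. The constant 7 is an integer above 2π. -/
theorem max_freq_le (ξ : Rn n) : max 1 (freq ξ) ≤ 7 * bracket 1 ξ :=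
  max_le (by linarith [one_le_bracket_one ξ]) (freq_le ξ)

theorem bracket_one_le_max_freq (ξ : Rn n) : bracket 1 ξ ≤ 2 * max 1 (freq ξ) := by
  have h1 : 1 ≤ max 1 (freq ξ) := le_max_left _ _
  have h2 : ‖ξ‖ ≤ max 1 (freq ξ) := by
    refine le_trans ?_ (le_max_right _ _)
    rw [freq]
    nlinarith [norm_nonneg ξ, Real.pi_gt_three]
  have h3 : ‖ξ‖ ^ 2 ≤ max 1 (freq ξ) ^ 2 := pow_le_pow_left₀ (norm_nonneg _) h2 2
  nlinarith [bracket_one_sq ξ, bracket_pos 1 ξ]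

/-- The decay rate of the Fourier modes. -/
def modeDecay (n : ℕ) (κ t : ℝ) : ℝ := Real.exp ((κ - n) * t / 2)

/-- Fourier modes of the de Sitter equation, with bounds uniform in frequency. -/
theorem exists_deSitter_modes (n : ℕ) {m μ : ℝ} (hμ : 0 < μ) (hmμ : μ ^ 2 = n ^ 2 - 4 * m ^ 2) :
    ∃ C : ℝ, 0 < C ∧ ∀ a b : ℝ, ∃ y z : ℝ → Rn n → ℝ,
      Continuous (Function.uncurry y) ∧ Continuous (Function.uncurry z) ∧
      (∀ ξ, y 0 ξ = a) ∧ (∀ ξ, z 0 ξ = b) ∧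
      (∀ t ξ, HasDerivAt (fun τ => y τ ξ) (z t ξ) t) ∧
      (∀ t ξ, 0 ≤ t → HasDerivAt (fun τ => z τ ξ)
        (-(freq ξ ^ 2 * Real.exp (-2 * t) + m ^ 2) * y t ξ - n * z t ξ) t) ∧
      ∀ t ξ, 0 ≤ t →
        |y t ξ| ≤ C * modeDecay n (max 1 μ) t * (|a| + |b| / bracket 1 ξ) ∧
        |z t ξ| ≤ C * modeDecay n (max 1 μ) t * bracket 1 ξ * (|a| + |b| / bracket 1 ξ) ∧
        (μ ≤ 1 → a = 0 → |y t ξ| ≤ C * modeDecay n μ t * |b|) := by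
  obtain ⟨C, hC, hmode⟩ := exists_mode_bound hμ
  -- As v = e^{nt/2} y, the data for v are (a, b + na/2), which costs 2 + n. The factor 7 + n covers
  -- the passage from max 1 |2πξ| to ⟨ξ⟩ and the term -nv/2 in the time derivative.
  refine ⟨C * (7 + n) * (2 + n), by positivity, fun a b => ?_⟩
  obtain ⟨v, w, hvc, hwc, hv0, hw0, hv, hw⟩ :=
    exists_mode_solution (continuous_freq (n := n)) (μ ^ 2 / 4) a (b + n / 2 * a)
  set e : ℝ → ℝ := fun t => Real.exp (-(n / 2 * t)) with he
  have hed : ∀ t, HasDerivAt e (-(n / 2) * e t) t := fun t =>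
    (((hasDerivAt_id t).const_mul ((n : ℝ) / 2)).neg.exp).congr_deriv (by
      simp only [he, Pi.neg_apply, id]
      ring)
  have hec : Continuous e := by
    rw [he]
    fun_prop
  have hyd : ∀ t ξ, HasDerivAt (fun τ => e τ * v τ ξ) (e t * (w t ξ - n / 2 * v t ξ)) t :=
    fun t ξ => ((hed t).mul (hv t ξ)).congr_deriv (by ring)
  refine ⟨fun t ξ => e t * v t ξ, fun t ξ => e t * (w t ξ - n / 2 * v t ξ), ?_, ?_, ?_, ?_, hyd,
    ?_, ?_⟩
  · exact (hec.comp continuous_fst).mul hvc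
  · exact (hec.comp continuous_fst).mul (hwc.sub (continuous_const.mul hvc))
  · intro ξ
    simp [he, hv0]
  · intro ξ
    simp [he, hv0, hw0]
  · intro t ξ ht
    refine ((hed t).mul ((hw t ξ).sub ((hv t ξ).const_mul ((n : ℝ) / 2)))).congr_deriv ?_
    rw [abs_of_nonneg ht, hmμ]
    simp only [Pi.sub_apply]
    ring
  · intro t ξ ht
    obtain ⟨h1, h2, h3⟩ := hmode (freq ξ) (fun t => v t ξ) (fun t => w t ξ) (freq_nonneg ξ)
      (fun t _ => hv t ξ) (fun s hs => by simpa [abs_of_nonneg hs] using hw s ξ) t ht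
    simp only [hv0, hw0] at h1 h2 h3
    set L := max 1 (freq ξ)
    have hL : 1 ≤ L := le_max_left _ _
    set J := bracket 1 ξ
    have hJ1 : 1 ≤ J := one_le_bracket_one ξ
    have hJL : J ≤ 2 * L := bracket_one_le_max_freq ξ
    have hLJ : L ≤ 7 * J := max_freq_le ξ
    set B := |a| + |b| / J with hB
    have hB0 : 0 ≤ B := by positivity
    have hn0 : (0 : ℝ) ≤ n := Nat.cast_nonneg n
    have hdat : |a| + |b + n / 2 * a| / L ≤ (2 + n) * B := by
      have i1 : |b + n / 2 * a| ≤ |b| + n / 2 * |a| := by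
        refine (abs_add_le _ _).trans_eq ?_
        rw [abs_mul, abs_of_nonneg (by positivity : (0 : ℝ) ≤ n / 2)]
      have i2 : |b + n / 2 * a| / L ≤ 2 * (|b| / J) + n / 2 * |a| := by
        rw [div_le_iff₀ (by linarith)]
        have i3 : |b| ≤ 2 * (|b| / J) * L := by
          calc |b| = |b| / J * J := by field_simp
            _ ≤ |b| / J * (2 * L) := mul_le_mul_of_nonneg_left hJL (by positivity)
            _ = _ := by ring
        have i4 : n / 2 * |a| ≤ n / 2 * |a| * L := le_mul_of_one_le_right (by positivity) hL
        linarith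
      have i5 : 0 ≤ n * (|b| / J) := by positivity
      have i6 : 0 ≤ n * |a| := by positivity
      have i7 := abs_nonneg a
      rw [hB]
      nlinarith
    have hdec : ∀ κ : ℝ, e t * Real.exp (κ * t / 2) = modeDecay n κ t := by
      intro κ
      rw [he, modeDecay, ← Real.exp_add]
      congr 1
      ring
    have het : 0 < e t := Real.exp_pos _
    have hD0 : 0 < modeDecay n (max 1 μ) t := Real.exp_pos _
    set D := modeDecay n (max 1 μ) t with hD
    have hv1 : e t * |v t ξ| ≤ C * D * ((2 + n) * B) := by
      calc e t * |v t ξ| ≤ e t * (C * Real.exp (max 1 μ * t / 2) *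
            (|a| + |b + n / 2 * a| / L)) := mul_le_mul_of_nonneg_left h1 het.le
        _ = C * D * (|a| + |b + n / 2 * a| / L) := by rw [hD, ← hdec]; ring
        _ ≤ _ := mul_le_mul_of_nonneg_left hdat (by positivity)
    have hw1 : e t * |w t ξ| ≤ C * D * (7 * J) * ((2 + n) * B) := by
      calc e t * |w t ξ| ≤ e t * (C * Real.exp (max 1 μ * t / 2) * L *
            (|a| + |b + n / 2 * a| / L)) := mul_le_mul_of_nonneg_left h2 het.le
        _ = C * D * L * (|a| + |b + n / 2 * a| / L) := by rw [hD, ← hdec]; ring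
        _ ≤ C * D * (7 * J) * (|a| + |b + n / 2 * a| / L) := by gcongr
        _ ≤ _ := mul_le_mul_of_nonneg_left hdat (by positivity)
    have hX0 : 0 ≤ C * D * ((2 + n) * B) := by positivity
    refine ⟨?_, ?_, fun hμ1 ha => ?_⟩
    · rw [abs_mul, abs_of_pos het]
      refine hv1.trans ?_
      calc C * D * ((2 + n) * B) ≤ C * D * ((2 + n) * B) * (7 + n) :=
            le_mul_of_one_le_right hX0 (by linarith)
        _ = _ := by ring
    · rw [abs_mul, abs_of_pos het]
      calc e t * |w t ξ - n / 2 * v t ξ| ≤ e t * (|w t ξ| + n / 2 * |v t ξ|) := by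
            refine mul_le_mul_of_nonneg_left ((abs_sub _ _).trans_eq ?_) het.le
            rw [abs_mul, abs_of_nonneg (by positivity : (0 : ℝ) ≤ n / 2)]
        _ = e t * |w t ξ| + n / 2 * (e t * |v t ξ|) := by ring
        _ ≤ C * D * (7 * J) * ((2 + n) * B) + n / 2 * (C * D * ((2 + n) * B)) := by gcongr
        _ ≤ C * D * (7 * J) * ((2 + n) * B) + n * J * (C * D * ((2 + n) * B)) := by
            gcongr
            nlinarith
        _ = _ := by ring
    · have h4 := h3 hμ1 ha
      rw [ha, mul_zero, add_zero] at h4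
      rw [abs_mul, abs_of_pos het]
      have hD' : 0 < modeDecay n μ t := Real.exp_pos _
      calc e t * |v t ξ| ≤ e t * (C * Real.exp (μ * t / 2) * |b|) :=
            mul_le_mul_of_nonneg_left h4 het.le
        _ = C * modeDecay n μ t * |b| := by rw [← hdec]; ring
        _ ≤ C * modeDecay n μ t * |b| * ((7 + n) * (2 + n)) :=
            le_mul_of_one_le_right (by positivity) (by nlinarith)
        _ = _ := by ring

end Modes

/-! ### Multiplication operators on L² -/

section Multipliers

open Filter Set
open scoped Topology ENNReal InnerProductSpace

variable {n : ℕ}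

/-- `L²(ℝⁿ)`. -/
abbrev L2 (n : ℕ) : Type := Lp ℂ 2 (volume : Measure (Rn n))

/-- Bounded continuous real symbols. -/
def IsSymbol (a : Rn n → ℝ) : Prop := Continuous a ∧ ∃ C, ∀ ξ, |a ξ| ≤ C

theorem IsSymbol.mul {a b : Rn n → ℝ} (ha : IsSymbol a) (hb : IsSymbol b) :
    IsSymbol fun ξ => a ξ * b ξ := by
  obtain ⟨ha, A, hA⟩ := ha
  obtain ⟨hb, B, hB⟩ := hb
  refine ⟨ha.mul hb, A * B, fun ξ => ?_⟩
  rw [abs_mul]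
  exact mul_le_mul (hA ξ) (hB ξ) (abs_nonneg _) ((abs_nonneg _).trans (hA ξ))

theorem IsSymbol.add {a b : Rn n → ℝ} (ha : IsSymbol a) (hb : IsSymbol b) :
    IsSymbol fun ξ => a ξ + b ξ := by
  obtain ⟨ha, A, hA⟩ := ha
  obtain ⟨hb, B, hB⟩ := hb
  exact ⟨ha.add hb, A + B, fun ξ => (abs_add_le _ _).trans (add_le_add (hA ξ) (hB ξ))⟩

theorem isSymbol_const (c : ℝ) : IsSymbol fun _ : Rn n => c :=
  ⟨continuous_const, |c|, fun _ => le_rfl⟩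

theorem IsSymbol.const_mul {a : Rn n → ℝ} (ha : IsSymbol a) (c : ℝ) :
    IsSymbol fun ξ => c * a ξ := (isSymbol_const c).mul ha

theorem IsSymbol.memLp {a : Rn n → ℝ} (ha : IsSymbol a) :
    MemLp (fun ξ => (a ξ : ℂ)) ∞ (volume : Measure (Rn n)) := by
  obtain ⟨hc, C, hC⟩ := ha
  exact memLp_top_of_bound (Complex.continuous_ofReal.comp hc).aestronglyMeasurable C
    (ae_of_all _ fun ξ => by simpa using hC ξ)

open Classical in
/-- Multiplication by a symbol, as an operator on `L²(ℝⁿ)`. -/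
def multiplier (a : Rn n → ℝ) : L2 n →L[ℂ] L2 n :=
  -- The default value 0 makes time-dependent families `multiplier (a t)` meaningful for all t,
  -- although bounds are available only for t ≥ 0.
  if ha : IsSymbol a then
    (ContinuousLinearMap.lsmul ℂ ℂ).holderL volume ∞ 2 2 (ha.memLp.toLp _)
  else 0

theorem coeFn_multiplier {a : Rn n → ℝ} (ha : IsSymbol a) (h : L2 n) :
    multiplier a h =ᵐ[volume] fun ξ => (a ξ : ℂ) * h ξ := by
  rw [multiplier, dif_pos ha]
  filter_upwards [(ContinuousLinearMap.lsmul ℂ ℂ).coeFn_holder (r := 2) (ha.memLp.toLp _) h,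
    ha.memLp.coeFn_toLp] with ξ h1 h2
  rw [ContinuousLinearMap.holderL_apply_apply, h1, h2]
  rfl

theorem multiplier_mul {a b : Rn n → ℝ} (ha : IsSymbol a) (hb : IsSymbol b) (h : L2 n) :
    multiplier a (multiplier b h) = multiplier (fun ξ => a ξ * b ξ) h := by
  apply Lp.ext
  filter_upwards [coeFn_multiplier ha (multiplier b h), coeFn_multiplier hb h,
    coeFn_multiplier (ha.mul hb) h] with ξ h1 h2 h3
  rw [h1, h2, h3]
  push_cast
  ring

theorem multiplier_comm {a b : Rn n → ℝ} (ha : IsSymbol a) (hb : IsSymbol b) (h : L2 n) :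
    multiplier a (multiplier b h) = multiplier b (multiplier a h) := by
  rw [multiplier_mul ha hb, multiplier_mul hb ha]
  simp_rw [mul_comm]

theorem multiplier_add {a b : Rn n → ℝ} (ha : IsSymbol a) (hb : IsSymbol b) (h : L2 n) :
    multiplier (fun ξ => a ξ + b ξ) h = multiplier a h + multiplier b h := by
  apply Lp.ext
  filter_upwards [coeFn_multiplier ha h, coeFn_multiplier hb h,
    coeFn_multiplier (ha.add hb) h, Lp.coeFn_add (multiplier a h) (multiplier b h)]
    with ξ h1 h2 h3 h4
  rw [h3, h4, Pi.add_apply, h1, h2]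
  push_cast
  ring

theorem multiplier_const_mul {a : Rn n → ℝ} (ha : IsSymbol a) (c : ℝ) (h : L2 n) :
    multiplier (fun ξ => c * a ξ) h = c • multiplier a h := by
  apply Lp.ext
  filter_upwards [coeFn_multiplier ha h, coeFn_multiplier (ha.const_mul c) h,
    Lp.coeFn_smul c (multiplier a h)] with ξ h1 h3 h4
  rw [h3, h4, Pi.smul_apply, h1, Complex.real_smul]
  push_cast
  ring

theorem multiplier_sub {a b : Rn n → ℝ} (ha : IsSymbol a) (hb : IsSymbol b) (h : L2 n) :
    multiplier (fun ξ => a ξ - b ξ) h = multiplier a h - multiplier b h := by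
  have h1 := multiplier_add ha (hb.const_mul (-1)) h
  rw [multiplier_const_mul hb] at h1
  simpa [sub_eq_add_neg] using h1

theorem multiplier_one (h : L2 n) : multiplier (fun _ => 1) h = h := by
  apply Lp.ext
  filter_upwards [coeFn_multiplier (isSymbol_const 1) h] with ξ h1
  simp [h1]

theorem norm_multiplier_le {a : Rn n → ℝ} (hac : Continuous a) {C : ℝ} (hC : ∀ ξ, |a ξ| ≤ C)
    (h : L2 n) : ‖multiplier a h‖ ≤ C * ‖h‖ := by
  apply Lp.norm_le_mul_norm_of_ae_le_mul
  filter_upwards [coeFn_multiplier ⟨hac, C, hC⟩ h] with ξ h1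
  rw [h1, norm_mul, Complex.norm_real]
  exact mul_le_mul_of_nonneg_right (hC ξ) (norm_nonneg _)

theorem multiplier_injective {a : Rn n → ℝ} (ha : IsSymbol a) (h0 : ∀ ξ, a ξ ≠ 0) {h : L2 n}
    (hh : multiplier a h = 0) : h = 0 := by
  apply Lp.ext
  filter_upwards [coeFn_multiplier ha h, Lp.coeFn_zero ℂ 2 (volume : Measure (Rn n))]
    with ξ h1 h2
  rw [hh, h2] at h1
  have h3 : h ξ = 0 := by simpa [h0 ξ] using h1.symm
  rw [h3, h2]
  rfl

/-- Symbols are real, hence the operators symmetric; the energy identity rests on this. -/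
theorem inner_multiplier {a : Rn n → ℝ} (ha : IsSymbol a) (g h : L2 n) :
    ⟪multiplier a g, h⟫_ℂ = ⟪g, multiplier a h⟫_ℂ := by
  rw [L2.inner_def, L2.inner_def]
  apply integral_congr_ae
  filter_upwards [coeFn_multiplier ha g, coeFn_multiplier ha h] with ξ h1 h2
  rw [h1, h2]
  simp only [RCLike.inner_apply, map_mul, Complex.conj_ofReal]
  ring

theorem norm_sq_eq_integral (h : L2 n) : ‖h‖ ^ 2 = ∫ ξ, ‖h ξ‖ ^ 2 := by
  have h1 : ((‖h‖ ^ 2 : ℝ) : ℂ) = ∫ ξ, ((‖h ξ‖ ^ 2 : ℝ) : ℂ) := by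
    have h2 := inner_self_eq_norm_sq_to_K (𝕜 := ℂ) h
    rw [L2.inner_def] at h2
    push_cast
    refine h2.symm.trans (integral_congr_ae (ae_of_all _ fun ξ => ?_))
    exact inner_self_eq_norm_sq_to_K (𝕜 := ℂ) (h ξ)
  rw [integral_complex_ofReal] at h1
  exact_mod_cast h1

/-- Dominated convergence for multipliers. -/
theorem tendsto_multiplier {ι : Type*} {l : Filter ι} [l.IsCountablyGenerated]
    {a : ι → Rn n → ℝ} {b : Rn n → ℝ} {M : ℝ} (hac : ∀ᶠ i in l, Continuous (a i))
    (ha : ∀ᶠ i in l, ∀ ξ, |a i ξ| ≤ M) (hb : IsSymbol b)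
    (hlim : ∀ ξ, Tendsto (fun i => a i ξ) l (𝓝 (b ξ))) (h : L2 n) :
    Tendsto (fun i => multiplier (a i) h) l (𝓝 (multiplier b h)) := by
  obtain ⟨B, hB⟩ := hb.2
  rw [tendsto_iff_norm_sub_tendsto_zero]
  have hsq : Tendsto (fun i => ∫ ξ, ‖((a i ξ - b ξ : ℝ) : ℂ) * h ξ‖ ^ 2) l (𝓝 0) := by
    have h0 : (0 : ℝ) = ∫ ξ : Rn n, (0 : ℝ) := by simp
    rw [h0]
    apply tendsto_integral_filter_of_dominated_convergence
      (fun ξ => (M + B) ^ 2 * ‖h ξ‖ ^ 2)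
    · filter_upwards [hac] with i hi
      have hc : Continuous fun ξ => ((a i ξ - b ξ : ℝ) : ℂ) :=
        Complex.continuous_ofReal.comp (hi.sub hb.1)
      exact (hc.aestronglyMeasurable.mul (Lp.aestronglyMeasurable h)).norm.pow 2
    · filter_upwards [ha] with i hi
      refine ae_of_all _ fun ξ => ?_
      rw [Real.norm_eq_abs, abs_of_nonneg (by positivity), norm_mul, mul_pow, Complex.norm_real]
      refine mul_le_mul_of_nonneg_right (pow_le_pow_left₀ (norm_nonneg _) ?_ 2) (by positivity)
      exact (abs_sub _ _).trans (add_le_add (hi ξ) (hB ξ))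
    · exact ((Lp.memLp h).integrable_norm_pow two_ne_zero).const_mul _
    · refine ae_of_all _ fun ξ => ?_
      have h1 : Tendsto (fun i => a i ξ - b ξ) l (𝓝 0) := by
        simpa using (hlim ξ).sub_const (b ξ)
      have h2 : Continuous fun x : ℝ => ‖(x : ℂ) * h ξ‖ ^ 2 := by fun_prop
      have h3 := (h2.tendsto 0).comp h1
      have h4 : ‖((0 : ℝ) : ℂ) * h ξ‖ ^ 2 = 0 := by simp
      rw [h4] at h3
      exact h3
  have hsq' : Tendsto (fun i => ‖multiplier (a i) h - multiplier b h‖ ^ 2) l (𝓝 0) := by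
    refine hsq.congr' ?_
    filter_upwards [hac, ha] with i hi hi'
    rw [norm_sq_eq_integral]
    apply integral_congr_ae
    filter_upwards [coeFn_multiplier ⟨hi, M, hi'⟩ h, coeFn_multiplier hb h,
      Lp.coeFn_sub (multiplier (a i) h) (multiplier b h)] with ξ h1 h2 h3
    rw [h3, Pi.sub_apply, h1, h2]
    push_cast
    ring_nf
  have := hsq'.sqrt
  simpa using this

theorem continuousOn_multiplier {a : ℝ → Rn n → ℝ} {M : ℝ} {s : Set ℝ}
    (hac : Continuous (Function.uncurry a)) (ha : ∀ t ∈ s, ∀ ξ, |a t ξ| ≤ M) (h : L2 n) :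
    ContinuousOn (fun t => multiplier (a t) h) s := by
  have hc : ∀ t, Continuous (a t) := fun t => hac.comp (Continuous.prodMk_right t)
  intro t ht
  refine tendsto_multiplier (M := M) (Eventually.of_forall hc)
    (eventually_mem_nhdsWithin.mono ha) ⟨hc t, M, ha t ht⟩ (fun ξ => ?_) h
  exact ((hac.comp (Continuous.prodMk_left ξ)).tendsto t).mono_left nhdsWithin_le_nhds

/-- The mean value inequality on the convex set s bounds the difference quotients by M uniformly in
ξ, so dominated convergence upgrades pointwise differentiability to the strong one. -/
theorem hasDerivWithinAt_multiplier {a b : ℝ → Rn n → ℝ} {M : ℝ} {s : Set ℝ} (hs : Convex ℝ s)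
    (ha : ∀ t ∈ s, IsSymbol (a t)) (hbc : ∀ t ∈ s, Continuous (b t))
    (hb : ∀ t ∈ s, ∀ ξ, |b t ξ| ≤ M)
    (hd : ∀ t ∈ s, ∀ ξ, HasDerivAt (fun τ => a τ ξ) (b t ξ) t) (h : L2 n) {t : ℝ} (ht : t ∈ s) :
    HasDerivWithinAt (fun τ => multiplier (a τ) h) (multiplier (b t) h) s t := by
  rw [hasDerivWithinAt_iff_tendsto_slope]
  have hev : ∀ᶠ τ in 𝓝[s \ {t}] t, τ ∈ s ∧ τ ≠ t := eventually_mem_nhdsWithin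
  have hslope : Tendsto (fun τ => multiplier (fun ξ => (τ - t)⁻¹ * (a τ ξ - a t ξ)) h)
      (𝓝[s \ {t}] t) (𝓝 (multiplier (b t) h)) := by
    refine tendsto_multiplier (M := M) ?_ ?_ ⟨hbc t ht, M, hb t ht⟩ (fun ξ => ?_) h
    · filter_upwards [hev] with τ hτ
      exact continuous_const.mul ((ha τ hτ.1).1.sub (ha t ht).1)
    · filter_upwards [hev] with τ hτ ξ
      have h1 := hs.norm_image_sub_le_of_norm_hasDerivWithin_le
        (fun x hx => (hd x hx ξ).hasDerivWithinAt) (fun x hx => hb x hx ξ) ht hτ.1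
      simp only [Real.norm_eq_abs] at h1
      rw [abs_mul, abs_inv, inv_mul_le_iff₀ (abs_pos.2 (sub_ne_zero.2 hτ.2))]
      linarith
    · have h1 := (hasDerivAt_iff_tendsto_slope.1 (hd t ht ξ)).mono_left
        (nhdsWithin_mono t (fun x hx => hx.2 : s \ {t} ⊆ {t}ᶜ))
      refine h1.congr fun τ => ?_
      rw [slope_def_field, div_eq_inv_mul]
  refine hslope.congr' ?_
  filter_upwards [hev] with τ hτ
  have hsub : IsSymbol fun ξ => a τ ξ - a t ξ := by
    simpa [sub_eq_add_neg] using (ha τ hτ.1).add ((ha t ht).const_mul (-1))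
  rw [multiplier_const_mul hsub, multiplier_sub (ha τ hτ.1) (ha t ht)]
  rfl

end Multipliers

/-! ### Sobolev spaces as L² on the Fourier side -/

section FourierRepresentation

open FourierTransform

variable {n : ℕ} {s : ℝ}

theorem hasTemperateGrowth_bracket (s : ℝ) :
    (fun ξ : Rn n => (bracket s ξ : ℂ)).HasTemperateGrowth := by
  unfold bracket
  fun_prop

theorem hasTemperateGrowth_freq_sq :
    (fun ξ : Rn n => ((freq ξ ^ 2 : ℝ) : ℂ)).HasTemperateGrowth := by
  unfold freq
  simp_rw [mul_pow]
  fun_prop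

theorem toTemperedDistribution_multiplier {a : Rn n → ℝ} (ha : IsSymbol a)
    (ha' : (fun ξ => (a ξ : ℂ)).HasTemperateGrowth) (h : L2 n) :
    ((multiplier a h : L2 n) : 𝓢'(Rn n, ℂ)) = smulLeftCLM ℂ (fun ξ => (a ξ : ℂ)) (h : 𝓢'(Rn n, ℂ)) := by
  ext η
  simp only [Lp.toTemperedDistribution_apply, smulLeftCLM_apply_apply]
  apply integral_congr_ae
  filter_upwards [coeFn_multiplier ha h] with ξ h1
  rw [h1, SchwartzMap.smulLeftCLM_apply_apply ha']
  simp only [smul_eq_mul]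
  ring

theorem smulLeftCLM_bracket_bracket (s s' : ℝ) (u : 𝓢'(Rn n, ℂ)) :
    smulLeftCLM ℂ (fun ξ => (bracket s ξ : ℂ)) (smulLeftCLM ℂ (fun ξ => (bracket s' ξ : ℂ)) u)
      = smulLeftCLM ℂ (fun ξ => (bracket (s + s') ξ : ℂ)) u := by
  rw [smulLeftCLM_smulLeftCLM_apply (hasTemperateGrowth_bracket _) (hasTemperateGrowth_bracket _)]
  congr 2
  ext ξ
  rw [Pi.mul_apply, ← Complex.ofReal_mul, mul_comm, bracket_mul]

/-- `u ↦ ⟨ξ⟩^s û`, from `H^s(ℝⁿ)` to `L²(ℝⁿ)`. -/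
def fourierRep (u : SobolevSpace n s) : L2 n := 𝓕 (bessel u)

theorem fourierRep_spec (u : SobolevSpace n s) :
    (fourierRep u : 𝓢'(Rn n, ℂ)) = smulLeftCLM ℂ (fun ξ => (bracket s ξ : ℂ)) (𝓕 (toDistr u)) := by
  rw [fourierRep, ← Lp.fourier_toTemperedDistribution_eq, bessel_spec,
    fourier_besselPotential_eq_smulLeftCLM_fourier_apply]
  rfl

theorem fourier_toDistr (u : SobolevSpace n s) :
    𝓕 (toDistr u) = smulLeftCLM ℂ (fun ξ => (bracket (-s) ξ : ℂ)) (fourierRep u : 𝓢'(Rn n, ℂ)) := by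
  rw [fourierRep_spec, smulLeftCLM_bracket_bracket, neg_add_cancel]
  simp [bracket_zero]

theorem exists_fourierRep_eq (h : L2 n) : ∃ u : SobolevSpace n s, fourierRep u = h := by
  have hmem : MemSobolev s 2
      (𝓕⁻ (smulLeftCLM ℂ (fun ξ => (bracket (-s) ξ : ℂ)) (h : 𝓢'(Rn n, ℂ)))) := by
    rw [memSobolev_iff_exists_smulLeftCLM_fourier]
    refine ⟨h, ?_⟩
    rw [fourier_fourierInv_eq]
    refine (smulLeftCLM_bracket_bracket s (-s) _).trans ?_
    rw [add_neg_cancel]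
    simp [bracket_zero]
  obtain ⟨u, hu⟩ : ∃ u : SobolevSpace n s, toDistr u =
      𝓕⁻ (smulLeftCLM ℂ (fun ξ => (bracket (-s) ξ : ℂ)) (h : 𝓢'(Rn n, ℂ))) := ⟨⟨_, hmem⟩, rfl⟩
  refine ⟨u, lp_toDistr_injective ?_⟩
  rw [Lp.toTemperedDistributionCLM_apply, Lp.toTemperedDistributionCLM_apply, fourierRep_spec, hu,
    fourier_fourierInv_eq, smulLeftCLM_bracket_bracket, add_neg_cancel]
  simp [bracket_zero]

/-- The isometry `u ↦ ⟨ξ⟩^s û` between `H^s(ℝⁿ)` and `L²(ℝⁿ)`. -/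
def fourierIso (n : ℕ) (s : ℝ) : SobolevSpace n s ≃ₗᵢ[ℂ] L2 n :=
  LinearIsometryEquiv.ofSurjective
    { toLinearMap := (Lp.fourierTransformₗᵢ (Rn n) ℂ).toLinearEquiv.toLinearMap ∘ₗ bessel
      norm_map' := fun u => (Lp.fourierTransformₗᵢ (Rn n) ℂ).norm_map (bessel u) }
    exists_fourierRep_eq

theorem fourierIso_apply (u : SobolevSpace n s) : fourierIso n s u = fourierRep u := rfl

theorem isSymbol_bracket_neg_one : IsSymbol (bracket (n := n) (-1)) :=
  ⟨continuous_bracket _, 1, fun ξ => by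
    rw [abs_of_pos (bracket_pos _ _)]
    exact bracket_neg_one_le_one ξ⟩

/-- Division by ⟨ξ⟩ makes |2πξ| bounded; the square of this operator carries the Laplacian in
`deSitterForce`. -/
theorem isSymbol_freq_mul_bracket : IsSymbol fun ξ : Rn n => freq ξ * bracket (-1) ξ :=
  ⟨continuous_freq.mul (continuous_bracket _), 7, fun ξ => by
    rw [abs_of_nonneg (mul_nonneg (freq_nonneg ξ) (bracket_pos _ _).le), bracket_neg_one,
      ← div_eq_mul_inv, div_le_iff₀ (bracket_pos _ _)]
    exact freq_le ξ⟩

/-- The weights of orders γ and γ - 1 differ by one power of ⟨ξ⟩, so the inclusion appears as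
multiplication by ⟨ξ⟩⁻¹. -/
theorem fourierRep_incl {γ : ℝ} (h : γ - 1 ≤ γ) (u : SobolevSpace n γ) :
    fourierRep (incl h u) = multiplier (bracket (-1)) (fourierRep u) := by
  apply lp_toDistr_injective
  rw [Lp.toTemperedDistributionCLM_apply, Lp.toTemperedDistributionCLM_apply,
    toTemperedDistribution_multiplier isSymbol_bracket_neg_one (hasTemperateGrowth_bracket _),
    fourierRep_spec, fourierRep_spec, toDistr_incl, smulLeftCLM_bracket_bracket,
    neg_add_eq_sub]

end FourierRepresentation

/-! ### The Cauchy problem on the Fourier side -/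

section FourierSide

open Set FourierTransform
open scoped InnerProductSpace Topology

variable {n : ℕ} {γ : ℝ}

/-- The right-hand side of the de Sitter equation, for `U = ⟨ξ⟩^γ φ̂` and `V = ⟨ξ⟩^{γ-1} φ̂_t`,
multiplied by `⟨ξ⟩^{γ-2}`. -/
def deSitterForce (n : ℕ) (m t : ℝ) (U V : L2 n) : L2 n :=
  -(Real.exp (-2 * t) • multiplier (fun ξ => freq ξ * bracket (-1) ξ)
      (multiplier (fun ξ => freq ξ * bracket (-1) ξ) U))
    - (n : ℝ) • multiplier (bracket (-1)) V
    - m ^ 2 • multiplier (bracket (-1)) (multiplier (bracket (-1)) U)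

/-- The Cauchy problem on the Fourier side, for `U = ⟨ξ⟩^γ φ̂` and `V = ⟨ξ⟩^{γ-1} φ̂_t`. -/
structure IsFourierSolution (n : ℕ) (m : ℝ) (F G : L2 n) (U V : ℝ → L2 n) : Prop where
  continuousOn : ContinuousOn U (Ici 0)
  continuousOn_deriv : ContinuousOn V (Ici 0)
  hasDeriv : ∀ t : ℝ, 0 ≤ t →
    HasDerivWithinAt (fun τ => multiplier (bracket (-1)) (U τ)) (V t) (Ici 0) t
  init : U 0 = F
  init_deriv : V 0 = G
  equation : ∀ t : ℝ, 0 < t → ∀ η : 𝓢(Rn n, ℂ),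
    HasDerivAt (fun τ : ℝ => (multiplier (bracket (-1)) (V τ) : 𝓢'(Rn n, ℂ)) η)
      ((deSitterForce n m t (U t) (V t) : 𝓢'(Rn n, ℂ)) η) t

theorem fourier_laplacian (T : 𝓢'(Rn n, ℂ)) :
    𝓕 (Δ T) = -smulLeftCLM ℂ (fun ξ => ((freq ξ ^ 2 : ℝ) : ℂ)) (𝓕 T) := by
  have h1 : (fun ξ : Rn n => ((freq ξ ^ 2 : ℝ) : ℂ))
      = ((2 * Real.pi : ℂ) ^ 2) • fun ξ : Rn n => Complex.ofReal (‖ξ‖ ^ 2) := by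
    ext ξ
    simp [freq, mul_pow]
  rw [laplacian_eq_fourierMultiplierCLM, h1, smulLeftCLM_smul (by fun_prop),
    fourierMultiplierCLM_apply]
  ext η
  simp only [TemperedDistribution.fourier_apply, FunLike.coe_smul, FunLike.coe_neg, Pi.smul_apply,
    Pi.neg_apply]
  rw [TemperedDistribution.fourierInv_apply, fourierInv_fourier_eq, neg_smul, Complex.real_smul,
    smul_eq_mul]
  push_cast
  rfl

/-- Test functions of this shape move the Fourier transform and the weight ⟨ξ⟩^{γ-2}, the order
natural for φ_tt, onto the distribution; what remains are powers of ⟨ξ⟩ independent of γ. -/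
theorem toDistr_fourier_apply {s : ℝ} (u : SobolevSpace n s) (η : 𝓢(Rn n, ℂ)) :
    toDistr u (𝓕 (SchwartzMap.smulLeftCLM ℂ (fun ξ => (bracket (γ - 2) ξ : ℂ)) η))
      = smulLeftCLM ℂ (fun ξ => (bracket (γ - 2 - s) ξ : ℂ)) (fourierRep u : 𝓢'(Rn n, ℂ)) η := by
  rw [← TemperedDistribution.fourier_apply, fourier_toDistr, ← smulLeftCLM_apply_apply,
    smulLeftCLM_bracket_bracket, ← sub_eq_add_neg]

theorem toDistr_fourier_apply_sub_one (u : SobolevSpace n (γ - 1)) (η : 𝓢(Rn n, ℂ)) :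
    toDistr u (𝓕 (SchwartzMap.smulLeftCLM ℂ (fun ξ => (bracket (γ - 2) ξ : ℂ)) η))
      = (multiplier (bracket (-1)) (fourierRep u) : 𝓢'(Rn n, ℂ)) η := by
  rw [toDistr_fourier_apply, toTemperedDistribution_multiplier isSymbol_bracket_neg_one
    (hasTemperateGrowth_bracket _), show γ - 2 - (γ - 1) = -1 by ring]

theorem toDistr_fourier_apply_self (u : SobolevSpace n γ) (η : 𝓢(Rn n, ℂ)) :
    toDistr u (𝓕 (SchwartzMap.smulLeftCLM ℂ (fun ξ => (bracket (γ - 2) ξ : ℂ)) η))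
      = (multiplier (bracket (-1)) (multiplier (bracket (-1)) (fourierRep u)) :
        𝓢'(Rn n, ℂ)) η := by
  rw [toDistr_fourier_apply, toTemperedDistribution_multiplier isSymbol_bracket_neg_one
    (hasTemperateGrowth_bracket _), toTemperedDistribution_multiplier isSymbol_bracket_neg_one
    (hasTemperateGrowth_bracket _), smulLeftCLM_bracket_bracket,
    show γ - 2 - γ = -1 + -1 by ring]

theorem laplacian_fourier_apply (u : SobolevSpace n γ) (η : 𝓢(Rn n, ℂ)) :
    (Δ (toDistr u)) (𝓕 (SchwartzMap.smulLeftCLM ℂ (fun ξ => (bracket (γ - 2) ξ : ℂ)) η))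
      = -(multiplier (fun ξ => freq ξ * bracket (-1) ξ)
        (multiplier (fun ξ => freq ξ * bracket (-1) ξ) (fourierRep u)) : 𝓢'(Rn n, ℂ)) η := by
  have hk := isSymbol_freq_mul_bracket (n := n)
  have h1 : (fun ξ : Rn n => ((freq ξ * bracket (-1) ξ * (freq ξ * bracket (-1) ξ) : ℝ) : ℂ))
      = (fun ξ => (bracket (-γ) ξ : ℂ)) * (fun ξ => ((freq ξ ^ 2 : ℝ) : ℂ)) *
        fun ξ => (bracket (γ - 2) ξ : ℂ) := by
    ext ξ
    simp only [Pi.mul_apply]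
    rw [← Complex.ofReal_mul, ← Complex.ofReal_mul]
    have h2 : bracket (-1) ξ * bracket (-1) ξ = bracket (-γ) ξ * bracket (γ - 2) ξ := by
      rw [bracket_mul, bracket_mul]
      congr 1
      ring
    congr 1
    linear_combination freq ξ ^ 2 * h2
  have hg1 := hasTemperateGrowth_bracket (n := n) (-γ)
  have hg2 := hasTemperateGrowth_freq_sq (n := n)
  have hg3 := hasTemperateGrowth_bracket (n := n) (γ - 2)
  rw [multiplier_mul hk hk, toTemperedDistribution_multiplier (hk.mul hk)
    (by rw [h1]; exact (hg1.mul hg2).mul hg3), h1,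
    ← smulLeftCLM_smulLeftCLM_apply (hg1.mul hg2) hg3, ← smulLeftCLM_smulLeftCLM_apply hg1 hg2,
    ← fourier_toDistr, ← TemperedDistribution.fourier_apply, fourier_laplacian]
  rfl

theorem toTemperedDistribution_deSitterForce (m t : ℝ) (U V : L2 n) (η : 𝓢(Rn n, ℂ)) :
    (deSitterForce n m t U V : 𝓢'(Rn n, ℂ)) η
      = (Real.exp (-2 * t) : ℂ) * -(multiplier (fun ξ => freq ξ * bracket (-1) ξ)
          (multiplier (fun ξ => freq ξ * bracket (-1) ξ) U) : 𝓢'(Rn n, ℂ)) η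
        - (n : ℂ) * (multiplier (bracket (-1)) V : 𝓢'(Rn n, ℂ)) η
        - (m : ℂ) ^ 2 * (multiplier (bracket (-1)) (multiplier (bracket (-1)) U) :
          𝓢'(Rn n, ℂ)) η := by
  have key : ∀ (a b c : ℝ) (x y z : L2 n),
      ((-(a • x) - b • y - c • z : L2 n) : 𝓢'(Rn n, ℂ)) η
        = (a : ℂ) * -(x : 𝓢'(Rn n, ℂ)) η - (b : ℂ) * (y : 𝓢'(Rn n, ℂ)) η
          - (c : ℂ) * (z : 𝓢'(Rn n, ℂ)) η := by
    intro a b c x y z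
    have h1 : (-(a • x) - b • y - c • z : L2 n)
        = (-(a : ℂ)) • x + (-(b : ℂ)) • y + (-(c : ℂ)) • z := by
      have hr : ∀ (r : ℝ) (x : L2 n), r • x = (r : ℂ) • x := RCLike.real_smul_eq_coe_smul
      rw [hr, hr, hr]
      module
    rw [h1]
    simp only [← Lp.toTemperedDistributionCLM_apply, map_add, map_smul]
    change -(a : ℂ) * (x : 𝓢'(Rn n, ℂ)) η + -(b : ℂ) * (y : 𝓢'(Rn n, ℂ)) η
      + -(c : ℂ) * (z : 𝓢'(Rn n, ℂ)) η = _
    simp only [Lp.toTemperedDistributionCLM_apply]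
    ring
  rw [deSitterForce, key]
  push_cast
  rfl

/-- Isometries transport continuity and strong derivatives in both directions; the weak equation is
matched by a bijective change of test function. -/
theorem isDeSitterSolution_iff {m : ℝ} {f : SobolevSpace n γ} {g : SobolevSpace n (γ - 1)}
    {φ : ℝ → SobolevSpace n γ} {φt : ℝ → SobolevSpace n (γ - 1)} :
    IsDeSitterSolution n m γ f g φ φt ↔
      IsFourierSolution n m (fourierIso n γ f) (fourierIso n (γ - 1) g)
        (fun t => fourierIso n γ (φ t)) (fun t => fourierIso n (γ - 1) (φt t)) := by
  have hD : ∀ t, HasDerivWithinAt (fun τ => incl (sub_le_self γ zero_le_one) (φ τ)) (φt t) (Ici 0) t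
      ↔ HasDerivWithinAt (fun τ => multiplier (bracket (-1)) (fourierIso n γ (φ τ)))
        (fourierIso n (γ - 1) (φt t)) (Ici 0) t := by
    intro t
    have e1 : (fun τ => multiplier (bracket (-1)) (fourierIso n γ (φ τ)))
        = fun τ => fourierIso n (γ - 1) (incl (sub_le_self γ zero_le_one) (φ τ)) :=
      funext fun τ => (fourierRep_incl _ _).symm
    rw [e1]
    let Φ : SobolevSpace n (γ - 1) →L[ℝ] L2 n :=
      ((fourierIso n (γ - 1)).toContinuousLinearEquiv : _ →L[ℂ] _).restrictScalars ℝ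
    let Ψ : L2 n →L[ℝ] SobolevSpace n (γ - 1) :=
      ((fourierIso n (γ - 1)).symm.toContinuousLinearEquiv : _ →L[ℂ] _).restrictScalars ℝ
    constructor
    · intro h
      exact Φ.hasFDerivAt.comp_hasDerivWithinAt t h
    · intro h
      have h2 := Ψ.hasFDerivAt.comp_hasDerivWithinAt t h
      have h3 : ∀ x, Ψ (fourierIso n (γ - 1) x) = x := fun x =>
        (fourierIso n (γ - 1)).symm_apply_apply x
      simpa only [Function.comp_def, h3] using h2
  have hE : ∀ (t : ℝ) (η : 𝓢(Rn n, ℂ)),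
      HasDerivAt (fun τ : ℝ => toDistr (φt τ)
          (𝓕 (SchwartzMap.smulLeftCLM ℂ (fun ξ => (bracket (γ - 2) ξ : ℂ)) η)))
        ((Real.exp (-2 * t) : ℂ) * (Δ (toDistr (φ t)))
            (𝓕 (SchwartzMap.smulLeftCLM ℂ (fun ξ => (bracket (γ - 2) ξ : ℂ)) η))
          - (n : ℂ) * toDistr (φt t)
            (𝓕 (SchwartzMap.smulLeftCLM ℂ (fun ξ => (bracket (γ - 2) ξ : ℂ)) η))
          - (m : ℂ) ^ 2 * toDistr (φ t)
            (𝓕 (SchwartzMap.smulLeftCLM ℂ (fun ξ => (bracket (γ - 2) ξ : ℂ)) η))) t ↔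
      HasDerivAt (fun τ : ℝ =>
          (multiplier (bracket (-1)) (fourierIso n (γ - 1) (φt τ)) : 𝓢'(Rn n, ℂ)) η)
        ((deSitterForce n m t (fourierIso n γ (φ t)) (fourierIso n (γ - 1) (φt t)) :
          𝓢'(Rn n, ℂ)) η) t := by
    intro t η
    simp_rw [toTemperedDistribution_deSitterForce, toDistr_fourier_apply_sub_one,
      toDistr_fourier_apply_self, laplacian_fourier_apply, fourierIso_apply]
  constructor
  · intro h
    exact ⟨(fourierIso n γ).continuous.comp_continuousOn h.continuousOn,
      (fourierIso n (γ - 1)).continuous.comp_continuousOn h.continuousOn_deriv,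
      fun t ht => (hD t).1 (h.hasDeriv t ht), by rw [h.init], by rw [h.init_deriv],
      fun t ht η => (hE t η).1 (h.equation t ht _)⟩
  · intro h
    refine ⟨?_, ?_, fun t ht => (hD t).2 (h.hasDeriv t ht), (fourierIso n γ).injective h.init,
      (fourierIso n (γ - 1)).injective h.init_deriv, fun t ht ψ => ?_⟩
    · simpa [Function.comp_def] using (fourierIso n γ).symm.continuous.comp_continuousOn h.continuousOn
    · simpa [Function.comp_def] using (fourierIso n (γ - 1)).symm.continuous.comp_continuousOn h.continuousOn_deriv
    -- η = ⟨ξ⟩^{2-γ} 𝓕⁻ψ recovers an arbitrary test function ψ.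
    · have hψ : 𝓕 (SchwartzMap.smulLeftCLM ℂ (fun ξ => (bracket (γ - 2) ξ : ℂ))
          (SchwartzMap.smulLeftCLM ℂ (fun ξ => (bracket (2 - γ) ξ : ℂ)) (𝓕⁻ ψ))) = ψ := by
        rw [SchwartzMap.smulLeftCLM_smulLeftCLM_apply (hasTemperateGrowth_bracket _)
          (hasTemperateGrowth_bracket _)]
        have h1 : ((fun ξ : Rn n => (bracket (γ - 2) ξ : ℂ)) * fun ξ => (bracket (2 - γ) ξ : ℂ))
            = fun _ => 1 := by
          ext ξ
          rw [Pi.mul_apply, ← Complex.ofReal_mul, bracket_mul]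
          simp [bracket_zero]
        rw [h1, SchwartzMap.smulLeftCLM_const]
        simp
      have h2 := (hE t _).2 (h.equation t ht
        (SchwartzMap.smulLeftCLM ℂ (fun ξ => (bracket (2 - γ) ξ : ℂ)) (𝓕⁻ ψ)))
      rwa [hψ] at h2

end FourierSide

/-! ### Uniqueness by the energy method -/

section Uniqueness

open Set Filter
open scoped InnerProductSpace Topology

variable {n : ℕ}

/-- Testing an `L²` function against a Schwartz function. -/
def testCLM (η : 𝓢(Rn n, ℂ)) : L2 n →L[ℝ] ℂ :=
  ((⟨{ toFun := fun h => (h : 𝓢'(Rn n, ℂ)) η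
       map_add' := fun g h => by
        simp only [← Lp.toTemperedDistributionCLM_apply, map_add]
        rfl
       map_smul' := fun c h => by
        simp only [← Lp.toTemperedDistributionCLM_apply, map_smul]
        rfl },
    (PointwiseConvergenceCLM.evalCLM (RingHom.id ℂ) ℂ η).continuous.comp
      (Lp.toTemperedDistributionCLM ℂ (volume : Measure (Rn n)) 2).continuous⟩ :
      L2 n →L[ℂ] ℂ)).restrictScalars ℝ

theorem testCLM_apply (η : 𝓢(Rn n, ℂ)) (h : L2 n) : testCLM η h = (h : 𝓢'(Rn n, ℂ)) η := rfl

theorem eq_of_testCLM_eq {g h : L2 n} (hgh : ∀ η, testCLM η g = testCLM η h) : g = h := by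
  apply lp_toDistr_injective
  ext η
  exact hgh η

/-- A weak `L²`-derivative which is continuous is a strong derivative. -/
theorem hasDerivAt_of_forall_testCLM {Z F : ℝ → L2 n} (hZ : ContinuousOn Z (Ici 0))
    (hF : ContinuousOn F (Ici 0))
    (hd : ∀ t, 0 < t → ∀ η, HasDerivAt (fun τ => testCLM η (Z τ)) (testCLM η (F t)) t)
    {t : ℝ} (ht : 0 < t) : HasDerivAt Z (F t) t := by
  have hFi : ∀ s, 0 ≤ s → IntervalIntegrable F volume 0 s := fun s hs =>
    (hF.mono (by rw [uIcc_of_le hs]; exact Icc_subset_Ici_self)).intervalIntegrable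
  -- Each test functional satisfies the scalar fundamental theorem of calculus, and test functionals
  -- separate points of L². A Bochner integral of a continuous function is then strongly
  -- differentiable.
  have hint : ∀ s, 0 ≤ s → Z s = Z 0 + ∫ τ in (0 : ℝ)..s, F τ := by
    intro s hs
    rw [← sub_eq_iff_eq_add']
    apply eq_of_testCLM_eq
    intro η
    rw [← (testCLM η).intervalIntegral_comp_comm (hFi s hs), map_sub]
    symm
    apply intervalIntegral.integral_eq_sub_of_hasDerivAt_of_le hs
    · exact (testCLM η).continuous.comp_continuousOn (hZ.mono Icc_subset_Ici_self)
    · exact fun τ hτ => hd τ hτ.1 η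
    · exact ((testCLM η).continuous.comp_continuousOn
        (hF.mono (by rw [uIcc_of_le hs]; exact Icc_subset_Ici_self))).intervalIntegrable
  have hFt : ContinuousAt F t := hF.continuousAt (Ici_mem_nhds ht)
  have hmeas : StronglyMeasurableAtFilter F (𝓝 t) volume :=
    (hF.mono Ioi_subset_Ici_self).stronglyMeasurableAtFilter isOpen_Ioi t ht
  refine ((intervalIntegral.integral_hasDerivAt_right (hFi t ht.le) hmeas hFt).const_add
    (Z 0)).congr_of_eventuallyEq ?_
  filter_upwards [Ioi_mem_nhds ht] with s hs
  exact hint s (le_of_lt hs)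

theorem hasDerivAt_norm_sq {Z : ℝ → L2 n} {Z' : L2 n} {t : ℝ} (h : HasDerivAt Z Z' t) :
    HasDerivAt (fun τ => ‖Z τ‖ ^ 2) (2 * (⟪Z t, Z'⟫_ℂ).re) t := by
  have h1 := Complex.reCLM.hasFDerivAt.comp_hasDerivAt t (h.inner ℂ h)
  have h2 : Complex.reCLM ∘ (fun τ => ⟪Z τ, Z τ⟫_ℂ) = fun τ => ‖Z τ‖ ^ 2 := by
    ext τ
    exact inner_self_eq_norm_sq (𝕜 := ℂ) (Z τ)
  rw [h2] at h1
  refine h1.congr_deriv ?_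
  rw [Complex.reCLM_apply, Complex.add_re, ← inner_conj_symm Z' (Z t), Complex.conj_re]
  ring

theorem deSitterForce_sub (m t : ℝ) (U V U' V' : L2 n) :
    deSitterForce n m t (U - U') (V - V') = deSitterForce n m t U V - deSitterForce n m t U' V' := by
  simp only [deSitterForce, map_sub, smul_sub]
  abel

theorem IsFourierSolution.sub {m : ℝ} {F G F' G' : L2 n} {U V U' V' : ℝ → L2 n}
    (h : IsFourierSolution n m F G U V) (h' : IsFourierSolution n m F' G' U' V') :
    IsFourierSolution n m (F - F') (G - G') (fun t => U t - U' t) (fun t => V t - V' t) where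
  continuousOn := h.continuousOn.sub h'.continuousOn
  continuousOn_deriv := h.continuousOn_deriv.sub h'.continuousOn_deriv
  hasDeriv t ht := by
    simp_rw [map_sub]
    exact (h.hasDeriv t ht).sub (h'.hasDeriv t ht)
  init := by rw [h.init, h'.init]
  init_deriv := by rw [h.init_deriv, h'.init_deriv]
  equation t ht η := by
    simp_rw [deSitterForce_sub, map_sub, ← testCLM_apply, map_sub]
    exact (h.equation t ht η).sub (h'.equation t ht η)

theorem continuousOn_deSitterForce {m : ℝ} {U V : ℝ → L2 n} {s : Set ℝ} (hU : ContinuousOn U s)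
    (hV : ContinuousOn V s) : ContinuousOn (fun t => deSitterForce n m t (U t) (V t)) s := by
  unfold deSitterForce
  fun_prop

/-- A solution with vanishing data vanishes: the energy
`‖⟨ξ⟩⁻¹V‖² + e^{-2t} ‖|2πξ|⟨ξ⟩⁻²U‖² + m² ‖⟨ξ⟩⁻²U‖²` does not increase. -/
theorem IsFourierSolution.eq_zero {m : ℝ} (hm : m ≠ 0) {U V : ℝ → L2 n}
    (h : IsFourierSolution n m 0 0 U V) {t : ℝ} (ht : 0 ≤ t) : U t = 0 ∧ V t = 0 := by
  set j : L2 n →L[ℂ] L2 n := multiplier (bracket (-1)) with hj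
  set k : L2 n →L[ℂ] L2 n := multiplier (fun ξ => freq ξ * bracket (-1) ξ) with hk
  have hjs := isSymbol_bracket_neg_one (n := n)
  have hks := isSymbol_freq_mul_bracket (n := n)
  have hjk : ∀ x, j (k x) = k (j x) := multiplier_comm hjs hks
  have hjsym : ∀ x y, ⟪j x, y⟫_ℂ = ⟪x, j y⟫_ℂ := inner_multiplier hjs
  have hksym : ∀ x y, ⟪k x, y⟫_ℂ = ⟪x, k y⟫_ℂ := inner_multiplier hks
  have hjinj : ∀ {x}, j x = 0 → x = 0 :=
    fun hx => multiplier_injective hjs (fun ξ => (bracket_pos _ ξ).ne') hx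
  have hZd : ∀ t, 0 < t → HasDerivAt (fun τ => j (V τ)) (deSitterForce n m t (U t) (V t)) t :=
    fun t ht => hasDerivAt_of_forall_testCLM (F := fun t => deSitterForce n m t (U t) (V t))
      (j.continuous.comp_continuousOn h.continuousOn_deriv)
      (continuousOn_deSitterForce h.continuousOn h.continuousOn_deriv) h.equation ht
  have hWd : ∀ t, 0 < t → HasDerivAt (fun τ => j (U τ)) (V t) t := fun t ht =>
    (h.hasDeriv t ht.le).hasDerivAt (Ici_mem_nhds ht)
  have hkWd : ∀ t, 0 < t → HasDerivAt (fun τ => k (j (U τ))) (k (V t)) t := fun t ht =>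
    (k.restrictScalars ℝ).hasFDerivAt.comp_hasDerivAt t (hWd t ht)
  have hjWd : ∀ t, 0 < t → HasDerivAt (fun τ => j (j (U τ))) (j (V t)) t := fun t ht =>
    (j.restrictScalars ℝ).hasFDerivAt.comp_hasDerivAt t (hWd t ht)
  have hexp : ∀ t : ℝ, HasDerivAt (fun τ : ℝ => Real.exp (-2 * τ)) (-2 * Real.exp (-2 * t)) t :=
    fun t => (((hasDerivAt_id t).const_mul (-2)).exp).congr_deriv (by simp [mul_comm])
  -- The energy sits at the level H^{γ-2} for φ_t, one order below the solution class, because only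
  -- there is φ_t strongly differentiable; no regularisation is needed.
  set E : ℝ → ℝ := fun τ => ‖j (V τ)‖ ^ 2 + Real.exp (-2 * τ) * ‖k (j (U τ))‖ ^ 2
    + m ^ 2 * ‖j (j (U τ))‖ ^ 2 with hE
  have hEd : ∀ t, 0 < t → HasDerivAt E
      (-(2 * n * ‖j (V t)‖ ^ 2) - 2 * Real.exp (-2 * t) * ‖k (j (U t))‖ ^ 2) t := by
    intro t ht
    refine (((hasDerivAt_norm_sq (hZd t ht)).add
      ((hexp t).mul (hasDerivAt_norm_sq (hkWd t ht)))).add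
      ((hasDerivAt_norm_sq (hjWd t ht)).const_mul (m ^ 2))).congr_deriv ?_
    have hr : ∀ (r : ℝ) (x : L2 n), r • x = (r : ℂ) • x := RCLike.real_smul_eq_coe_smul
    -- Symmetry and commutation bring the force term into the form produced by differentiating ‖k (j
    -- U)‖², so that the two cancel.
    have i1 : ⟪j (V t), k (k (U t))⟫_ℂ = ⟪k (V t), k (j (U t))⟫_ℂ := by
      rw [hjsym, hjk, hjk, ← hksym]
    have i2 : (⟪j (V t), j (V t)⟫_ℂ).re = ‖j (V t)‖ ^ 2 := inner_self_eq_norm_sq (𝕜 := ℂ) _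
    have i3 : (⟪j (V t), deSitterForce n m t (U t) (V t)⟫_ℂ).re
        = -(Real.exp (-2 * t) * (⟪k (j (U t)), k (V t)⟫_ℂ).re) - n * ‖j (V t)‖ ^ 2
          - m ^ 2 * (⟪j (j (U t)), j (V t)⟫_ℂ).re := by
      rw [deSitterForce, hr, hr, hr, inner_sub_right, inner_sub_right, inner_neg_right,
        inner_smul_right, inner_smul_right, inner_smul_right, i1, Complex.sub_re, Complex.sub_re,
        Complex.neg_re, Complex.re_ofReal_mul, Complex.re_ofReal_mul, Complex.re_ofReal_mul, i2,
        ← inner_conj_symm, Complex.conj_re, ← inner_conj_symm (j (V t)) (j (j (U t))),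
        Complex.conj_re]
    rw [i3]
    ring
  have hEc : ContinuousOn E (Ici 0) := by
    have hU := h.continuousOn
    have hV := h.continuousOn_deriv
    rw [hE]
    fun_prop
  have hanti : AntitoneOn E (Ici 0) := by
    refine antitoneOn_of_deriv_nonpos (convex_Ici 0) hEc ?_ ?_
    · rw [interior_Ici]
      exact fun s hs => (hEd s hs).differentiableAt.differentiableWithinAt
    · rw [interior_Ici]
      intro s hs
      rw [(hEd s hs).deriv]
      have h1 : 0 ≤ 2 * (n : ℝ) * ‖j (V s)‖ ^ 2 := by positivity
      have h2 : 0 ≤ 2 * Real.exp (-2 * s) * ‖k (j (U s))‖ ^ 2 := by positivity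
      linarith
  have hE0 : E 0 = 0 := by simp [hE, h.init, h.init_deriv]
  have hEt : E t ≤ 0 := hE0 ▸ hanti self_mem_Ici ht ht
  have p1 : 0 ≤ ‖j (V t)‖ ^ 2 := by positivity
  have p2 : 0 ≤ Real.exp (-2 * t) * ‖k (j (U t))‖ ^ 2 := by positivity
  have p3 : 0 ≤ m ^ 2 * ‖j (j (U t))‖ ^ 2 := by positivity
  have q1 : ‖j (V t)‖ ^ 2 = 0 := by
    simp only [hE] at hEt
    linarith
  have q3 : m ^ 2 * ‖j (j (U t))‖ ^ 2 = 0 := by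
    simp only [hE] at hEt
    linarith
  constructor
  -- The mass term controls U: m ≠ 0, and j is injective because its symbol never vanishes.
  · have : ‖j (j (U t))‖ = 0 := by simpa [hm] using q3
    exact hjinj (hjinj (norm_eq_zero.1 this))
  · have : ‖j (V t)‖ = 0 := by simpa using q1
    exact hjinj (norm_eq_zero.1 this)

theorem IsFourierSolution.unique {m : ℝ} (hm : m ≠ 0) {F G : L2 n} {U V U' V' : ℝ → L2 n}
    (h : IsFourierSolution n m F G U V) (h' : IsFourierSolution n m F G U' V') {t : ℝ}
    (ht : 0 ≤ t) : U t = U' t ∧ V t = V' t := by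
  have h1 := h.sub h'
  rw [sub_self, sub_self] at h1
  obtain ⟨h2, h3⟩ := h1.eq_zero hm ht
  exact ⟨sub_eq_zero.1 h2, sub_eq_zero.1 h3⟩

end Uniqueness

/-! ### Existence and decay from the modes -/

section Existence

open Set Filter
open scoped Topology

variable {n : ℕ}

theorem deSitterForce_add (m t : ℝ) (U V U' V' : L2 n) :
    deSitterForce n m t (U + U') (V + V') = deSitterForce n m t U V + deSitterForce n m t U' V' := by
  simp only [deSitterForce, map_add, smul_add]
  abel

theorem IsFourierSolution.add {m : ℝ} {F G F' G' : L2 n} {U V U' V' : ℝ → L2 n}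
    (h : IsFourierSolution n m F G U V) (h' : IsFourierSolution n m F' G' U' V') :
    IsFourierSolution n m (F + F') (G + G') (fun t => U t + U' t) (fun t => V t + V' t) where
  continuousOn := h.continuousOn.add h'.continuousOn
  continuousOn_deriv := h.continuousOn_deriv.add h'.continuousOn_deriv
  hasDeriv t ht := by
    simp_rw [map_add]
    exact (h.hasDeriv t ht).add (h'.hasDeriv t ht)
  init := by rw [h.init, h'.init]
  init_deriv := by rw [h.init_deriv, h'.init_deriv]
  equation t ht η := by
    simp_rw [deSitterForce_add, map_add, ← testCLM_apply, map_add]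
    exact (h.equation t ht η).add (h'.equation t ht η)

/-- Every operator in the force is a multiplier, so for solutions of this form the equation reduces
to an ODE at each ξ. -/
theorem deSitterForce_multiplier {m t : ℝ} {a b : Rn n → ℝ} (ha : IsSymbol a) (hb : IsSymbol b)
    (H : L2 n) :
    deSitterForce n m t (multiplier a H) (multiplier b H)
      = multiplier (fun ξ => bracket (-1) ξ * (bracket (-1) ξ *
          (-(freq ξ ^ 2 * Real.exp (-2 * t) + m ^ 2) * a ξ) - n * b ξ)) H := by
  have hj := isSymbol_bracket_neg_one (n := n)
  have hk := isSymbol_freq_mul_bracket (n := n)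
  have h1 := (hk.mul (hk.mul ha)).const_mul (-Real.exp (-2 * t))
  have h2 := (hj.mul hb).const_mul (-n)
  have h3 := (hj.mul (hj.mul ha)).const_mul (-m ^ 2)
  have h4 : (fun ξ => bracket (-1) ξ * (bracket (-1) ξ *
        (-(freq ξ ^ 2 * Real.exp (-2 * t) + m ^ 2) * a ξ) - n * b ξ))
      = fun ξ => -Real.exp (-2 * t) * (freq ξ * bracket (-1) ξ * (freq ξ * bracket (-1) ξ * a ξ))
        + -n * (bracket (-1) ξ * b ξ) + -m ^ 2 * (bracket (-1) ξ * (bracket (-1) ξ * a ξ)) := by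
    ext ξ
    ring
  rw [h4, multiplier_add (h1.add h2) h3, multiplier_add h1 h2,
    multiplier_const_mul (hk.mul (hk.mul ha)), multiplier_const_mul (hj.mul hb),
    multiplier_const_mul (hj.mul (hj.mul ha)), deSitterForce, multiplier_mul hk ha,
    multiplier_mul hk (hk.mul ha), multiplier_mul hj hb, multiplier_mul hj ha,
    multiplier_mul hj (hj.mul ha)]
  module

/-- The uniform domination needed to differentiate ⟨ξ⟩⁻¹V in time; 49 is the square of the bound 7
for |2πξ|⟨ξ⟩⁻¹. -/
theorem abs_force_symbol_le {m t C x y : ℝ} {ξ : Rn n} (ht0 : 0 ≤ t) (hx : |x| ≤ C) (hy : |y| ≤ C) :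
    |bracket (-1) ξ * (bracket (-1) ξ * (-(freq ξ ^ 2 * Real.exp (-2 * t) + m ^ 2) * x) - n * y)|
      ≤ (49 + m ^ 2) * C + n * C := by
  set J := bracket (-1) ξ with hJ
  have hJ0 : 0 < J := bracket_pos _ _
  have hJ1 : J ≤ 1 := bracket_neg_one_le_one ξ
  have hfJ : freq ξ * J ≤ 7 := by
    rw [hJ, bracket_neg_one, ← div_eq_mul_inv, div_le_iff₀ (bracket_pos _ _)]
    exact freq_le ξ
  have hfJ0 : 0 ≤ freq ξ * J := mul_nonneg (freq_nonneg ξ) hJ0.le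
  have he : Real.exp (-2 * t) ≤ 1 := Real.exp_le_one_iff.2 (by linarith)
  have he0 := Real.exp_pos (-2 * t)
  have hC : 0 ≤ C := (abs_nonneg _).trans hx
  have hc1 : (freq ξ * J) ^ 2 * Real.exp (-2 * t) + m ^ 2 * J ^ 2 ≤ 49 + m ^ 2 := by
    have s1 : (freq ξ * J) ^ 2 ≤ 49 := by nlinarith
    have s2 : (freq ξ * J) ^ 2 * Real.exp (-2 * t) ≤ 49 * 1 :=
      mul_le_mul s1 he he0.le (by norm_num)
    have s3 : m ^ 2 * J ^ 2 ≤ m ^ 2 * 1 :=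
      mul_le_mul_of_nonneg_left (pow_le_one₀ hJ0.le hJ1) (sq_nonneg m)
    linarith
  have hc0 : 0 ≤ (freq ξ * J) ^ 2 * Real.exp (-2 * t) + m ^ 2 * J ^ 2 := by positivity
  calc _ = |-(((freq ξ * J) ^ 2 * Real.exp (-2 * t) + m ^ 2 * J ^ 2) * x)
        - n * J * y| := by
        congr 1
        ring
    _ ≤ |-(((freq ξ * J) ^ 2 * Real.exp (-2 * t) + m ^ 2 * J ^ 2) * x)|
        + |n * J * y| := abs_sub _ _
    _ = ((freq ξ * J) ^ 2 * Real.exp (-2 * t) + m ^ 2 * J ^ 2) * |x|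
        + n * J * |y| := by
        rw [abs_neg, abs_mul, abs_of_nonneg hc0, abs_mul (n * J),
          abs_of_nonneg (by positivity : 0 ≤ n * J)]
    _ ≤ (49 + m ^ 2) * C + n * C := by
        refine add_le_add (mul_le_mul hc1 hx (abs_nonneg _) (by positivity)) ?_
        exact mul_le_mul (mul_le_of_le_one_right (Nat.cast_nonneg n) hJ1) hy
          (abs_nonneg _) (Nat.cast_nonneg n)

/-- Bounded symbols `(Y, Z)` which solve the Fourier-side equation for each frequency act on `L²` as
solution operators. -/
theorem isFourierSolution_of_symbols {m C : ℝ} {Y Z : ℝ → Rn n → ℝ}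
    (hYc : Continuous (Function.uncurry Y)) (hZc : Continuous (Function.uncurry Z))
    (hY : ∀ t ξ, HasDerivAt (fun τ => bracket (-1) ξ * Y τ ξ) (Z t ξ) t)
    (hZ : ∀ t ξ, 0 ≤ t → HasDerivAt (fun τ => bracket (-1) ξ * Z τ ξ) (bracket (-1) ξ *
      (bracket (-1) ξ * (-(freq ξ ^ 2 * Real.exp (-2 * t) + m ^ 2) * Y t ξ) - n * Z t ξ)) t)
    (hYb : ∀ t ξ, 0 ≤ t → |Y t ξ| ≤ C) (hZb : ∀ t ξ, 0 ≤ t → |Z t ξ| ≤ C) (H : L2 n) :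
    IsFourierSolution n m (multiplier (Y 0) H) (multiplier (Z 0) H)
      (fun t => multiplier (Y t) H) (fun t => multiplier (Z t) H) := by
  have hjc : Continuous (bracket (n := n) (-1)) := continuous_bracket _
  have hj := isSymbol_bracket_neg_one (n := n)
  have hYs : ∀ t, 0 ≤ t → IsSymbol (Y t) := fun t ht =>
    ⟨hYc.comp (Continuous.prodMk_right t), C, fun ξ => hYb t ξ ht⟩
  have hZs : ∀ t, 0 ≤ t → IsSymbol (Z t) := fun t ht =>
    ⟨hZc.comp (Continuous.prodMk_right t), C, fun ξ => hZb t ξ ht⟩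
  refine ⟨continuousOn_multiplier hYc (fun t ht ξ => hYb t ξ ht) H,
    continuousOn_multiplier hZc (fun t ht ξ => hZb t ξ ht) H, fun t ht => ?_, rfl, rfl,
    fun t ht η => ?_⟩
  · have h1 := hasDerivWithinAt_multiplier (a := fun t ξ => bracket (-1) ξ * Y t ξ) (b := Z)
      (convex_Ici 0) (fun t ht => hj.mul (hYs t ht)) (fun t ht => (hZs t ht).1)
      (fun t ht ξ => hZb t ξ ht) (fun t _ ξ => hY t ξ) H ht
    refine h1.congr_of_mem (fun τ hτ => ?_) ht
    exact multiplier_mul hj (hYs τ hτ) H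
  · have h1 := hasDerivWithinAt_multiplier (a := fun t ξ => bracket (-1) ξ * Z t ξ)
      (b := fun t ξ => bracket (-1) ξ * (bracket (-1) ξ *
          (-(freq ξ ^ 2 * Real.exp (-2 * t) + m ^ 2) * Y t ξ) - n * Z t ξ))
      (convex_Ici 0) (fun t ht => hj.mul (hZs t ht)) (fun t ht => by
        have c1 := (hYs t ht).1
        have c2 := (hZs t ht).1
        have c3 := continuous_freq (n := n)
        fun_prop) (fun t ht ξ => abs_force_symbol_le ht (hYb t ξ ht) (hZb t ξ ht))
      (fun t ht ξ => hZ t ξ ht) H ht.le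
    rw [← deSitterForce_multiplier (hYs t ht.le) (hZs t ht.le)] at h1
    have h2 := (h1.congr_of_mem (fun τ hτ => multiplier_mul hj (hZs τ hτ) H)
      (le_of_lt ht)).hasDerivAt (Ici_mem_nhds ht)
    exact (testCLM η).hasFDerivAt.comp_hasDerivAt t h2

/-- A family of Fourier modes `(y, z)`, weighted by `p`, gives a solution on the Fourier side as
soon as `p y` and `⟨ξ⟩⁻¹ p z` are bounded. -/
theorem isFourierSolution_of_modes {m C : ℝ} {y z : ℝ → Rn n → ℝ}
    (hyc : Continuous (Function.uncurry y)) (hzc : Continuous (Function.uncurry z))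
    (hy : ∀ t ξ, HasDerivAt (fun τ => y τ ξ) (z t ξ) t)
    (hz : ∀ t ξ, 0 ≤ t → HasDerivAt (fun τ => z τ ξ)
        (-(freq ξ ^ 2 * Real.exp (-2 * t) + m ^ 2) * y t ξ - n * z t ξ) t)
    {p : Rn n → ℝ} (hp : Continuous p)
    (hyb : ∀ t ξ, 0 ≤ t → |p ξ * y t ξ| ≤ C)
    (hzb : ∀ t ξ, 0 ≤ t → |bracket (-1) ξ * (p ξ * z t ξ)| ≤ C) (H : L2 n) :
    IsFourierSolution n m (multiplier (fun ξ => p ξ * y 0 ξ) H)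
      (multiplier (fun ξ => bracket (-1) ξ * (p ξ * z 0 ξ)) H)
      (fun t => multiplier (fun ξ => p ξ * y t ξ) H)
      (fun t => multiplier (fun ξ => bracket (-1) ξ * (p ξ * z t ξ)) H) := by
  have hjc : Continuous (bracket (n := n) (-1)) := continuous_bracket _
  refine isFourierSolution_of_symbols (Y := fun t ξ => p ξ * y t ξ)
    (Z := fun t ξ => bracket (-1) ξ * (p ξ * z t ξ)) ((hp.comp continuous_snd).mul hyc)
    ((hjc.comp continuous_snd).mul ((hp.comp continuous_snd).mul hzc))
    (fun t ξ => ((hy t ξ).const_mul (p ξ)).const_mul (bracket (-1) ξ)) (fun t ξ ht => ?_) hyb hzb H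
  exact ((((hz t ξ ht).const_mul (p ξ)).const_mul (bracket (-1) ξ)).const_mul
    (bracket (-1) ξ)).congr_deriv (by ring)

/-- Existence on the Fourier side, with decay. -/
theorem exists_isFourierSolution (n : ℕ) {m μ : ℝ} (hμ : 0 < μ) (hμn : μ < n)
    (hmμ : μ ^ 2 = n ^ 2 - 4 * m ^ 2) :
    ∃ C : ℝ, 0 < C ∧ ∀ F G : L2 n, ∃ U V : ℝ → L2 n, IsFourierSolution n m F G U V ∧
      ∀ t, 0 ≤ t →
        ‖U t‖ ≤ C * modeDecay n (max 1 μ) t * (‖F‖ + ‖G‖) ∧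
        ‖V t‖ ≤ C * modeDecay n (max 1 μ) t * (‖F‖ + ‖G‖) ∧
        (μ ≤ 1 → ∀ H, multiplier (bracket (-1)) H = G →
          ‖U t‖ ≤ C * (modeDecay n (max 1 μ) t * ‖F‖ + modeDecay n μ t * ‖H‖)) := by
  obtain ⟨C, hC, hmodes⟩ := exists_deSitter_modes n hμ hmμ
  -- Fundamental solutions with data (1, 0) and (0, 1). The second is later weighted by ⟨ξ⟩, since G
  -- carries one power of ⟨ξ⟩ less than U.
  obtain ⟨y₁, z₁, hyc₁, hzc₁, hy₁0, hz₁0, hy₁, hz₁, hb₁⟩ := hmodes 1 0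
  obtain ⟨y₂, z₂, hyc₂, hzc₂, hy₂0, hz₂0, hy₂, hz₂, hb₂⟩ := hmodes 0 1
  refine ⟨C, hC, fun F G => ?_⟩
  have hn1 : (1 : ℝ) ≤ n := by
    have h0 : 0 < n := by
      rw [← Nat.cast_pos (α := ℝ)]
      exact hμ.trans hμn
    exact_mod_cast h0
  -- As max(1, μ) ≤ n, the rate is never a growth, so the symbols are bounded uniformly in t ≥ 0.
  have hD1 : ∀ t, 0 ≤ t → modeDecay n (max 1 μ) t ≤ 1 := by
    intro t ht
    rw [modeDecay, Real.exp_le_one_iff]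
    have : max 1 μ ≤ n := max_le hn1 hμn.le
    have h2 : (max 1 μ - n) * t ≤ 0 := mul_nonpos_of_nonpos_of_nonneg (by linarith) ht
    linarith
  have hCD : ∀ t, 0 ≤ t → C * modeDecay n (max 1 μ) t ≤ C := fun t ht =>
    mul_le_of_le_one_right hC.le (hD1 t ht)
  have hJ : ∀ ξ : Rn n, bracket (-1) ξ * bracket 1 ξ = 1 := bracket_neg_mul 1
  have b1 : ∀ t ξ, 0 ≤ t → |1 * y₁ t ξ| ≤ C * modeDecay n (max 1 μ) t := fun t ξ ht => by
    simpa using (hb₁ t ξ ht).1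
  have b2 : ∀ t ξ, 0 ≤ t → |bracket (-1) ξ * (1 * z₁ t ξ)| ≤ C * modeDecay n (max 1 μ) t := by
    intro t ξ ht
    have h := (hb₁ t ξ ht).2.1
    rw [abs_one, abs_zero, zero_div, add_zero, mul_one] at h
    rw [one_mul, abs_mul, abs_of_pos (bracket_pos _ _)]
    refine (mul_le_mul_of_nonneg_left h (bracket_pos _ _).le).trans_eq ?_
    linear_combination C * modeDecay n (max 1 μ) t * hJ ξ
  have b3 : ∀ t ξ, 0 ≤ t → |bracket 1 ξ * y₂ t ξ| ≤ C * modeDecay n (max 1 μ) t := by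
    intro t ξ ht
    have h := (hb₂ t ξ ht).1
    rw [abs_one, abs_zero, zero_add, one_div, ← bracket_neg_one] at h
    rw [abs_mul, abs_of_pos (bracket_pos _ _)]
    refine (mul_le_mul_of_nonneg_left h (bracket_pos _ _).le).trans_eq ?_
    linear_combination C * modeDecay n (max 1 μ) t * hJ ξ
  have b4 : ∀ t ξ, 0 ≤ t →
      |bracket (-1) ξ * (bracket 1 ξ * z₂ t ξ)| ≤ C * modeDecay n (max 1 μ) t := by
    intro t ξ ht
    have h := (hb₂ t ξ ht).2.1
    rw [abs_one, abs_zero, zero_add, one_div, ← bracket_neg_one, mul_assoc, mul_comm (bracket 1 ξ),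
      hJ, mul_one] at h
    rwa [← mul_assoc, hJ, one_mul]
  have hc : ∀ {y : ℝ → Rn n → ℝ}, Continuous (Function.uncurry y) → ∀ t, Continuous (y t) :=
    fun hy t => hy.comp (Continuous.prodMk_right t)
  have hJc : ∀ s, Continuous (bracket (n := n) s) := continuous_bracket
  have s1 := isFourierSolution_of_modes hyc₁ hzc₁ hy₁ hz₁ (p := fun _ => 1) continuous_const
    (fun t ξ ht => (b1 t ξ ht).trans (hCD t ht)) (fun t ξ ht => (b2 t ξ ht).trans (hCD t ht)) F
  have s2 := isFourierSolution_of_modes hyc₂ hzc₂ hy₂ hz₂ (hJc 1)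
    (fun t ξ ht => (b3 t ξ ht).trans (hCD t ht)) (fun t ξ ht => (b4 t ξ ht).trans (hCD t ht)) G
  have s := s1.add s2
  have hzero : ∀ h : L2 n, multiplier (fun _ => 0) h = 0 := by
    intro h
    simpa using multiplier_const_mul (isSymbol_const (n := n) 1) 0 h
  simp only [hy₁0, hz₁0, hy₂0, hz₂0, mul_one, mul_zero, hJ, multiplier_one, hzero, add_zero,
    zero_add] at s
  refine ⟨_, _, s, fun t ht => ?_⟩
  have n1 : ‖multiplier (fun ξ => 1 * y₁ t ξ) F‖ ≤ C * modeDecay n (max 1 μ) t * ‖F‖ :=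
    norm_multiplier_le (continuous_const.mul (hc hyc₁ t)) (fun ξ => b1 t ξ ht) F
  have n2 : ‖multiplier (fun ξ => bracket (-1) ξ * (1 * z₁ t ξ)) F‖
      ≤ C * modeDecay n (max 1 μ) t * ‖F‖ :=
    norm_multiplier_le ((hJc _).mul (continuous_const.mul (hc hzc₁ t))) (fun ξ => b2 t ξ ht) F
  have n3 : ‖multiplier (fun ξ => bracket 1 ξ * y₂ t ξ) G‖ ≤ C * modeDecay n (max 1 μ) t * ‖G‖ :=
    norm_multiplier_le ((hJc _).mul (hc hyc₂ t)) (fun ξ => b3 t ξ ht) G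
  have n4 : ‖multiplier (fun ξ => bracket (-1) ξ * (bracket 1 ξ * z₂ t ξ)) G‖
      ≤ C * modeDecay n (max 1 μ) t * ‖G‖ :=
    norm_multiplier_le ((hJc _).mul ((hJc _).mul (hc hzc₂ t))) (fun ξ => b4 t ξ ht) G
  refine ⟨?_, ?_, fun hμ1 H hH => ?_⟩
  · rw [mul_add]
    exact norm_add_le_of_le n1 n3
  · rw [mul_add]
    exact norm_add_le_of_le n2 n4
  -- For G = ⟨ξ⟩⁻¹H the weight ⟨ξ⟩ cancels, and the unweighted bound for y₂ with the faster rate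
  -- applies.
  · have h1 : multiplier (fun ξ => bracket 1 ξ * y₂ t ξ) G = multiplier (y₂ t) H := by
      have hs : IsSymbol fun ξ => bracket 1 ξ * y₂ t ξ :=
        ⟨(hJc _).mul (hc hyc₂ t), _, fun ξ => b3 t ξ ht⟩
      rw [← hH, multiplier_mul hs isSymbol_bracket_neg_one]
      congr 2
      ext ξ
      linear_combination y₂ t ξ * hJ ξ
    have n5 : ‖multiplier (y₂ t) H‖ ≤ C * modeDecay n μ t * ‖H‖ :=
      norm_multiplier_le (hc hyc₂ t) (fun ξ => by simpa using (hb₂ t ξ ht).2.2 hμ1 rfl) H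
    rw [← h1] at n5
    rw [mul_add, ← mul_assoc, ← mul_assoc]
    exact norm_add_le_of_le n1 n5

end Existence

end

/-! ### Return to Sobolev spaces -/

theorem corollary3p4 (n : ℕ) (m μ γ : ℝ) (hm : 0 < m)
    (hμ : μ = Real.sqrt ((n : ℝ) ^ 2 - 4 * m ^ 2)) (hμ_mem : μ ∈ Set.Ioo (0 : ℝ) n)
    (hγ : 1 ≤ γ) :
    ∃ C : ℝ, 0 < C ∧
      ∀ (f : SobolevSpace n γ) (g : SobolevSpace n (γ - 1)),
        ∃ (φ : ℝ → SobolevSpace n γ) (φt : ℝ → SobolevSpace n (γ - 1)),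
          IsDeSitterSolution n m γ f g φ φt ∧
          (∀ (φ' : ℝ → SobolevSpace n γ) (φt' : ℝ → SobolevSpace n (γ - 1)),
            IsDeSitterSolution n m γ f g φ' φt' → ∀ t : ℝ, 0 ≤ t → φ' t = φ t ∧ φt' t = φt t) ∧
          (μ < 1 → ∀ t : ℝ, 0 ≤ t →
            ‖φ t‖ ≤ C * Real.exp (-(((n : ℝ) - 1) * t / 2)) * (‖f‖ + ‖g‖) ∧
            ‖φt t‖ ≤ C * Real.exp (-(((n : ℝ) - 1) * t / 2)) * (‖f‖ + ‖g‖)) ∧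
          (1 ≤ μ → ∀ t : ℝ, 0 ≤ t →
            ‖φ t‖ ≤ C * Real.exp ((-(n : ℝ) + μ) * t / 2) * (‖f‖ + ‖g‖) ∧
            ‖φt t‖ ≤ C * Real.exp ((-(n : ℝ) + μ) * t / 2) * (‖f‖ + ‖g‖)) ∧
          (μ < 1 → ∀ gγ : SobolevSpace n γ, SobolevSpace.incl (sub_le_self γ zero_le_one) gγ = g →
            ∀ t : ℝ, 0 ≤ t →
              ‖φ t‖ ≤ C * Real.exp (-(((n : ℝ) - 1) * t / 2)) *
                (‖f‖ + Real.exp (-((1 - μ) * t / 2)) * ‖gγ‖)) := by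
  have hμ0 : 0 < μ := hμ_mem.1
  -- `Real.sqrt` vanishes on negative numbers, so μ > 0 already forces a positive radicand.
  have hmμ : μ ^ 2 = (n : ℝ) ^ 2 - 4 * m ^ 2 := by
    rw [hμ, Real.sq_sqrt]
    exact (Real.sqrt_pos.1 (hμ ▸ hμ0)).le
  obtain ⟨C, hC, hsol⟩ := exists_isFourierSolution n hμ0 hμ_mem.2 hmμ
  refine ⟨C, hC, fun f g => ?_⟩
  obtain ⟨U, V, hUV, hb⟩ := hsol (fourierIso n γ f) (fourierIso n (γ - 1) g)
  simp only [LinearIsometryEquiv.norm_map] at hb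
  have hd1 : μ ≤ 1 → ∀ t, modeDecay n (max 1 μ) t = Real.exp (-(((n : ℝ) - 1) * t / 2)) := by
    intro h t
    rw [max_eq_left h, modeDecay]
    congr 1
    ring
  have hd2 : 1 ≤ μ → ∀ t, modeDecay n (max 1 μ) t = Real.exp ((-(n : ℝ) + μ) * t / 2) := by
    intro h t
    rw [max_eq_right h, modeDecay]
    congr 1
    ring
  have hφ : IsDeSitterSolution n m γ f g (fun t => (fourierIso n γ).symm (U t))
      (fun t => (fourierIso n (γ - 1)).symm (V t)) := by
    rw [isDeSitterSolution_iff]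
    simpa only [LinearIsometryEquiv.apply_symm_apply] using hUV
  refine ⟨_, _, hφ, fun φ' φt' h' t ht => ?_, fun h1 t ht => ?_, fun h1 t ht => ?_,
    fun h1 gγ hgγ t ht => ?_⟩
  · obtain ⟨h2, h3⟩ := (isDeSitterSolution_iff.1 h').unique hm.ne' (isDeSitterSolution_iff.1 hφ) ht
    exact ⟨(fourierIso n γ).injective h2, (fourierIso n (γ - 1)).injective h3⟩
  · simp only [LinearIsometryEquiv.norm_map, ← hd1 h1.le t]
    exact ⟨(hb t ht).1, (hb t ht).2.1⟩
  · simp only [LinearIsometryEquiv.norm_map, ← hd2 h1 t]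
    exact ⟨(hb t ht).1, (hb t ht).2.1⟩
  -- The extra regularity of g enters here: H = ⟨ξ⟩^γ ĝ lies in L² and satisfies ⟨ξ⟩⁻¹H = G.
  · have h2 := (hb t ht).2.2 h1.le (fourierIso n γ gγ) (by
      rw [fourierIso_apply, fourierIso_apply, ← hgγ, fourierRep_incl])
    rw [LinearIsometryEquiv.norm_map, hd1 h1.le] at h2
    rw [LinearIsometryEquiv.norm_map]
    refine h2.trans_eq ?_
    have h3 : modeDecay n μ t
        = Real.exp (-(((n : ℝ) - 1) * t / 2)) * Real.exp (-((1 - μ) * t / 2)) := by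
      rw [modeDecay, ← Real.exp_add]
      congr 1
      ring
    rw [h3]
    ring
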